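/- Let $n\ge 0$ and let $\lambda$ and $\rho=(\rho_1\ge\rho_2\ge\cdots\ge\rho_l>0)$ be partitions of $n$. Write $\chi^{\lambda}_{\rho}$ for the value of the irreducible character of the symmetric group $S_n$ labelled by $\lambda$ (the character of the Specht module of shape $\lambda$) at the conjugacy class of permutations of cycle type $\rho$. Then $$\chi^{\lambda}_{\rho}=\sum_{\substack{\mu\vartriangleleft\rho\\ |\mu|\ge\lambda_1}}\ \sum_{\tau\vdash|\mu|-\lambda_1}\frac{(-1)^{l(\tau)}}{z_\tau}\,\chi^{\lambda\setminus\lambda_1}_{(\rho\setminus\mu)\cup\tau}.$$ Here $\lambda_1$ is the largest part of $\lambda$ (with $\lambda_1=0$ if $\lambda=\emptyset$), and $\lambda\setminus\lambda_1$ is the partition of $n-\lambda_1$ obtained by removing the first row of $\lambda$ (it is $\emptyset$ if $\lambda=\emptyset$). The outer sum runs over the sub-partitions $\mu=(\rho_{i_1},\ldots,\rho_{i_s})$ of $\rho$, $1\le i_1<\cdots<i_s\le l$, $0\le s\le l$, one for each of the $2^{l}$ sets of positions $\{i_1,\ldots,i_s\}$ (so equal sub-partitions arising from different positions are counted separately),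 subject to $|\mu|=\rho_{i_1}+\cdots+\rho_{i_s}\ge\lambda_1$; $\rho\setminus\mu$ consists of the parts of $\rho$ at the remaining positions. The inner sum runs over all partitions $\tau$ of $|\mu|-\lambda_1$; $l(\tau)$ is the number of parts of $\tau$, $z_\tau=\prod_{i\ge1}i^{m_i}m_i!$ with $m_i$ the number of parts of $\tau$ equal to $i$, and $(\rho\setminus\mu)\cup\tau$ is the partition of $n-\lambda_1$ whose parts are those of $\rho\setminus\mu$ together with those of $\tau$. -/

import Mathlib

noncomputable section

namespace SymChar

open Equiv

variable {n : ℕ}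

/-! ### Partitions -/

/-- The parts `λ₁ ≥ λ₂ ≥ ⋯ ≥ λ_l > 0` of a partition, in decreasing order. -/
def rows (p : n.Partition) : List ℕ := p.parts.sort (· ≥ ·)

/-- The largest part `λ₁` (`0` for the empty partition). -/
def firstPart (p : n.Partition) : ℕ := p.parts.sup

/-- `l(λ)`, the number of parts. -/
def len (p : n.Partition) : ℕ := p.parts.card

/-- `z_λ = ∏ i ^ mᵢ * mᵢ!`, where `mᵢ` is the number of parts equal to `i`. -/
def zee (p : n.Partition) : ℕ :=
  ∏ i ∈ p.parts.toFinset, i ^ p.parts.count i * (p.parts.count i).factorial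

theorem firstPart_mem (p : n.Partition) (h : p.parts ≠ 0) : firstPart p ∈ p.parts := by
  have key : ∀ s : Multiset ℕ, s ≠ 0 → s.sup ∈ s := by
    intro s
    induction s using Multiset.induction with
    | empty => simp
    | cons a s ih =>
      intro _
      by_cases hs : s = 0
      · subst hs; simp
      · rw [Multiset.sup_cons]
        rcases le_total a s.sup with h1 | h1
        · rw [sup_eq_right.2 h1]; exact Multiset.mem_cons_of_mem (ih hs)
        · rw [sup_eq_left.2 h1]; exact Multiset.mem_cons_self _ _
  exact key _ h

/-- The partition `λ ∖ λ₁` of `n - λ₁`: one copy of the largest part is removed. -/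
def removeFirst (p : n.Partition) : (n - firstPart p).Partition where
  parts := p.parts.erase (firstPart p)
  parts_pos hi := p.parts_pos (Multiset.mem_of_mem_erase hi)
  parts_sum := by
    by_cases h : p.parts = 0
    · have := p.parts_sum
      simp [h] at this
      simp [h, ← this]
    · have h1 := Multiset.sum_erase (firstPart_mem p h)
      rw [p.parts_sum] at h1
      omega

/-- A sub-partition `μ = (ρ_{i₁}, …, ρ_{i_s})`, `i₁ < ⋯ < i_s`, of `ρ = (ρ₁, …, ρ_l)` is given by
its set `S = {i₁, …, i_s}` of positions, so that there are `2 ^ l` of them;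
`subParts ρ S` is the multiset of its parts. -/
def subParts (ρ : n.Partition) (S : Finset (Fin (rows ρ).length)) : Multiset ℕ :=
  S.val.map fun i => (rows ρ).get i

/-- `|μ|` for the sub-partition `μ` of `ρ` at the positions `S`. -/
def subSize (ρ : n.Partition) (S : Finset (Fin (rows ρ).length)) : ℕ := (subParts ρ S).sum

theorem subParts_add_compl (ρ : n.Partition) (S : Finset (Fin (rows ρ).length)) :
    subParts ρ Sᶜ + subParts ρ S = ρ.parts := by
  have h1 : (Sᶜ).val + S.val = (Finset.univ : Finset (Fin (rows ρ).length)).val := by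
    rw [← Finset.union_compl S, Finset.union_comm,
      ← Finset.disjUnion_eq_union _ _ disjoint_compl_left]
    rfl
  unfold subParts
  rw [← Multiset.map_add, h1]
  have h2 : ((rows ρ : List ℕ) : Multiset ℕ) = ρ.parts := Multiset.sort_eq _ _
  conv_rhs => rw [← h2, ← List.ofFn_get (rows ρ)]
  rw [Fin.univ_val_map]

/-- `(ρ ∖ μ) ∪ τ`, for the sub-partition `μ` of `ρ` at the positions `S` and `τ ⊢ |μ| - m`:
the parts of `ρ` outside `S` together with the parts of `τ`. It is a partition of `n - m`. -/
def replace (ρ : n.Partition) (S : Finset (Fin (rows ρ).length)) {m : ℕ} (h : m ≤ subSize ρ S)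
    (τ : (subSize ρ S - m).Partition) : (n - m).Partition where
  parts := subParts ρ Sᶜ + τ.parts
  parts_pos := by
    intro i hi
    rcases Multiset.mem_add.1 hi with hi | hi
    · refine ρ.parts_pos (i := i) ?_
      rw [← subParts_add_compl ρ S]
      exact Multiset.mem_add.2 (Or.inl hi)
    · exact τ.parts_pos hi
  parts_sum := by
    have h1 := congrArg Multiset.sum (subParts_add_compl ρ S)
    rw [Multiset.sum_add, ρ.parts_sum] at h1
    rw [Multiset.sum_add, τ.parts_sum]
    unfold subSize at *
    omega

/-! ### Young diagrams and tableaux -/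

/-- The Young diagram of a partition: row `i` has as many cells as the `i`-th largest part. -/
def diagram (p : n.Partition) : YoungDiagram :=
  YoungDiagram.ofRowLens (rows p) (Multiset.pairwise_sort p.parts (· ≥ ·)).sortedGE

theorem card_diagram (p : n.Partition) : (diagram p).cells.card = n := by
  have key : ∀ w : List ℕ, (YoungDiagram.cellsOfRowLens w).card = w.sum := by
    intro w
    induction w with
    | nil => simp [YoungDiagram.cellsOfRowLens]
    | cons a w ih =>
      rw [YoungDiagram.cellsOfRowLens, Finset.card_union_of_disjoint, List.sum_cons,
        Finset.card_map, ih]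
      · simp
      · rw [Finset.disjoint_left]
        rintro ⟨i, j⟩ h1 h2
        simp at h1 h2
        omega
  refine (key (rows p)).trans ?_
  rw [← Multiset.sum_coe]
  unfold rows
  rw [Multiset.sort_eq, p.parts_sum]

/-- A tableau of shape `λ ⊢ n`: a bijective filling of the cells of `λ` by the `n` letters. -/
abbrev Tableau (p : n.Partition) : Type := Fin n ≃ {c : ℕ × ℕ // c ∈ (diagram p).cells}

instance (p : n.Partition) : Nonempty (Tableau p) :=
  ⟨(Finset.equivFinOfCardEq (card_diagram p)).symm⟩

/-- The permutations that keep each letter in its row of `T`. -/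
def rowGroup {p : n.Partition} (T : Tableau p) : Set (Perm (Fin n)) :=
  {σ | ∀ k, (T (σ k)).1.1 = (T k).1.1}

/-- The permutations that keep each letter in its column of `T`. -/
def colGroup {p : n.Partition} (T : Tableau p) : Set (Perm (Fin n)) :=
  {σ | ∀ k, (T (σ k)).1.2 = (T k).1.2}

/-! ### Irreducible characters of the symmetric group -/

open Classical in
/-- The row symmetrizer `∑ σ`, over the row group. -/
def rowSymmetrizer {p : n.Partition} (T : Tableau p) : MonoidAlgebra ℂ (Perm (Fin n)) :=
  ∑ σ ∈ Finset.univ.filter (· ∈ rowGroup T), MonoidAlgebra.single σ (1 : ℂ)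

open Classical in
/-- The column antisymmetrizer `∑ sgn(σ) σ`, over the column group. -/
def colSymmetrizer {p : n.Partition} (T : Tableau p) : MonoidAlgebra ℂ (Perm (Fin n)) :=
  ∑ σ ∈ Finset.univ.filter (· ∈ colGroup T),
    MonoidAlgebra.single σ (((Perm.sign σ : ℤ) : ℂ))

/-- The Young symmetrizer of a tableau. -/
def youngSymmetrizer {p : n.Partition} (T : Tableau p) : MonoidAlgebra ℂ (Perm (Fin n)) :=
  rowSymmetrizer T * colSymmetrizer T

/-- The Specht module of `T`: the left ideal of `ℂ[S_n]` generated by the Young symmetrizer. -/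
def spechtModule {p : n.Partition} (T : Tableau p) : Ideal (MonoidAlgebra ℂ (Perm (Fin n))) :=
  Ideal.span {youngSymmetrizer T}

/-- The representation of `S_n` on the Specht module, by left multiplication. -/
def spechtRep {p : n.Partition} (T : Tableau p) :
    Representation ℂ (Perm (Fin n)) (spechtModule T) :=
  Representation.ofModule' (spechtModule T)

theorem exists_perm (ρ : n.Partition) : ∃ σ : Perm (Fin n), σ.partition.parts = ρ.parts := by
  have h0 : (ρ.parts.filter (2 ≤ ·)) + (ρ.parts.filter (fun i => ¬ 2 ≤ i)) = ρ.parts :=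
    Multiset.filter_add_not _ _
  have h1 : ρ.parts.filter (fun i => ¬ 2 ≤ i) =
      Multiset.replicate (ρ.parts.filter (fun i => ¬ 2 ≤ i)).card 1 := by
    rw [Multiset.eq_replicate]
    refine ⟨rfl, fun i hi => ?_⟩
    have := Multiset.mem_filter.1 hi
    have := ρ.parts_pos this.1
    omega
  have hs := congrArg Multiset.sum h0
  rw [h1, Multiset.sum_add, Multiset.sum_replicate, ρ.parts_sum, smul_eq_mul, mul_one] at hs
  obtain ⟨σ, hσ⟩ := (Perm.exists_with_cycleType_iff (Fin n) (m := ρ.parts.filter (2 ≤ ·))).2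
    ⟨by rw [Fintype.card_fin]; omega, fun a ha => (Multiset.mem_filter.1 ha).2⟩
  refine ⟨σ, ?_⟩
  rw [Perm.parts_partition, ← Perm.sum_cycleType, hσ, Fintype.card_fin]
  conv_rhs => rw [← h0, h1]
  congr 2
  omega

/-- `χ^λ_ρ`: the value of the irreducible character `χ^λ` of `S_n`, the character of the Specht
module of shape `λ` (for any tableau), at the class of the permutations with cycle type `ρ`, fixed
points counted as parts `1`. -/
def chi (p ρ : n.Partition) : ℂ :=
  (spechtRep (Classical.arbitrary (Tableau p))).character (exists_perm ρ).choose

/-- The representative of the conjugacy class does not matter. -/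
theorem chi_eq (p ρ : n.Partition) (σ : Perm (Fin n)) (h : σ.partition.parts = ρ.parts) :
    chi p ρ = (spechtRep (Classical.arbitrary (Tableau p))).character σ := by
  have h1 : IsConj σ (exists_perm ρ).choose :=
    Perm.partition_eq_of_isConj.2
      (Nat.Partition.ext (h.trans (exists_perm ρ).choose_spec.symm))
  obtain ⟨g, hg⟩ := isConj_iff.1 h1
  unfold chi
  rw [← hg, Representation.char_conj]

end SymChar

end

/-!
The recursion is the expansion of Frobenius' character formula along the first variable. That
formula, `SymChar.chi_eq_coeff`, says that `χ^λ_ρ` is the coefficient of `x ^ (λ + δ)` in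
`a_δ(x) p_ρ(x)`, where `a_δ = ∏_{i < j} (x_i - x_j)`. Split off `x_0`. The alternant becomes
`∏ (x_0 - x_i)` times the alternant of the other variables, and each factor of `p_ρ` becomes
`x_0 ^ r + p_r(x')`, so `p_ρ` is a sum over the sets `S` of positions that contribute a power of
`x_0`. The coefficient of `x_0 ^ (λ₁ + l)` forces the elementary symmetric polynomial `e_k` with
`k = |μ| - λ₁`, and `(-1) ^ k e_k = ∑_τ (-1) ^ l(τ) p_τ / z_τ` (`SymChar.neg_one_pow_mul_esymm`, by
Newton's identities). What remains is Frobenius' formula for `λ ∖ λ₁`.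

To prove Frobenius' formula for the Specht module, let `ψ` be the class function given by the
coefficients (`SymChar.frobCoeff`), and `χ` the character of the left ideal generated by the Young
symmetrizer `c = a b`. Both are real-valued, so `ψ = χ` follows from
`⟨χ, χ⟩ = ⟨ψ, χ⟩ = ⟨ψ, ψ⟩ = 1`, which makes the norm of `ψ - χ` vanish.

* `⟨χ, χ⟩ = 1` (`SymChar.sum_character_mul_self`): as `a y b` is always a multiple of `c`, one has
  `c² = κ c`, and `κ χ(x)` is the trace of `y ↦ x y c` on the group algebra; for `x = c` this map
  has rank one.
* `⟨ψ, χ⟩ = 1` (`SymChar.sum_frobCoeff_mul_character`): expanding the alternant writes `ψ` as the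
  signed sum over `w` of the permutation characters on colourings of content `λ + δ - w δ`. For
  `w ≠ 1` this content is not dominated by `λ`, so in every colouring two letters of one column
  share a colour, and the pairing vanishes. For `w = 1` it is `1`.
* `⟨ψ, ψ⟩ = 1` (`SymChar.sum_frobCoeff_mul_self`): summing `p_σ(x) p_σ(y)` over `S_n` gives `n!`
  times the complete symmetric polynomial of the products `x_i y_j`, and Cauchy's determinant
  (`SymChar.det_cauchy`) evaluates the required coefficient of its product with both alternants.
-/

noncomputable section

namespace SymChar

open Equiv

variable {n : ℕ}

/-! ### Column-injective fillings of a tableau -/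

/-- The row of the letter `k` in the tableau `T`. -/
def rowIdx {p : n.Partition} (T : Tableau p) (k : Fin n) : ℕ := (T k).1.1

/-- The column of the letter `k` in the tableau `T`. -/
def colIdx {p : n.Partition} (T : Tableau p) (k : Fin n) : ℕ := (T k).1.2

theorem eq_of_rowIdx_eq_of_colIdx_eq {p : n.Partition} (T : Tableau p) {k k' : Fin n}
    (h1 : rowIdx T k = rowIdx T k') (h2 : colIdx T k = colIdx T k') : k = k' :=
  T.injective (Subtype.ext (Prod.ext h1 h2))

theorem rowIdx_lt_colLen {p : n.Partition} (T : Tableau p) (k : Fin n) :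
    rowIdx T k < (diagram p).colLen (colIdx T k) :=
  YoungDiagram.mem_iff_lt_colLen.1 (T k).2

theorem exists_letter {p : n.Partition} (T : Tableau p) {i j : ℕ}
    (h : i < (diagram p).colLen j) : ∃ k, rowIdx T k = i ∧ colIdx T k = j := by
  refine ⟨T.symm ⟨(i, j), YoungDiagram.mem_iff_lt_colLen.2 h⟩, ?_, ?_⟩ <;> simp [rowIdx, colIdx]

theorem card_col_rowIdx_lt {p : n.Partition} (T : Tableau p) {i j : ℕ}
    (h : i ≤ (diagram p).colLen j) :
    (Finset.univ.filter fun k => colIdx T k = j ∧ rowIdx T k < i).card = i := by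
  have : ((Finset.univ.filter fun k => colIdx T k = j ∧ rowIdx T k < i).image (rowIdx T)) =
      Finset.range i := by
    ext r
    simp only [Finset.mem_image, Finset.mem_filter, Finset.mem_univ, true_and, Finset.mem_range]
    constructor
    · rintro ⟨k, ⟨_, hk⟩, rfl⟩
      exact hk
    · intro hr
      obtain ⟨k, hk1, hk2⟩ := exists_letter T (hr.trans_le h)
      exact ⟨k, ⟨hk2, hk1 ▸ hr⟩, hk1⟩
  rw [← Finset.card_image_of_injOn (f := rowIdx T), this, Finset.card_range]
  intro k hk k' hk' e
  simp only [Finset.coe_filter, Finset.mem_univ, true_and, Set.mem_ofPred_eq] at hk hk'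
  exact eq_of_rowIdx_eq_of_colIdx_eq T e (hk.1.trans hk'.1.symm)

/-- In each column, a filling with distinct entries has at most as many entries `< i` as the
filling by row indices. -/
theorem card_col_lt_le {p : n.Partition} (T : Tableau p) (f : Fin n → ℕ)
    (hf : ∀ k k', colIdx T k = colIdx T k' → f k = f k' → k = k') (i j : ℕ) :
    (Finset.univ.filter fun k => colIdx T k = j ∧ f k < i).card ≤
      (Finset.univ.filter fun k => colIdx T k = j ∧ rowIdx T k < i).card := by
  rcases le_total i ((diagram p).colLen j) with h | h
  · rw [card_col_rowIdx_lt T h, ← Finset.card_range i]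
    refine Finset.card_le_card_of_injOn f ?_ ?_
    · intro k hk
      simp only [Finset.coe_filter, Finset.mem_univ, true_and, Set.mem_ofPred_eq] at hk
      simpa using hk.2
    · intro k hk k' hk' e
      simp only [Finset.coe_filter, Finset.mem_univ, true_and, Set.mem_ofPred_eq] at hk hk'
      exact hf k k' (hk.1.trans hk'.1.symm) e
  · refine Finset.card_le_card fun k hk => ?_
    simp only [Finset.mem_filter, Finset.mem_univ, true_and] at hk ⊢
    refine ⟨hk.1, lt_of_lt_of_le ?_ h⟩
    rw [← hk.1]
    exact rowIdx_lt_colLen T k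

theorem card_filter_lt_eq_sum_col {p : n.Partition} (T : Tableau p) (f : Fin n → ℕ) (i : ℕ) :
    (Finset.univ.filter fun k => f k < i).card =
      ∑ j ∈ Finset.univ.image (colIdx T),
        (Finset.univ.filter fun k => colIdx T k = j ∧ f k < i).card := by
  rw [Finset.card_eq_sum_card_fiberwise (f := colIdx T) (t := Finset.univ.image (colIdx T))]
  · refine Finset.sum_congr rfl fun j _ => ?_
    rw [Finset.filter_filter]
    simp only [and_comm]
  · intro k _
    simp

/-- The content of a filling whose columns have distinct entries is dominated by the shape. -/
theorem card_lt_le_of_injective_on_columns {p : n.Partition} (T : Tableau p) (f : Fin n → ℕ)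
    (hf : ∀ k k', colIdx T k = colIdx T k' → f k = f k' → k = k') (i : ℕ) :
    (Finset.univ.filter fun k => f k < i).card ≤
      (Finset.univ.filter fun k => rowIdx T k < i).card := by
  rw [card_filter_lt_eq_sum_col T f, card_filter_lt_eq_sum_col T (rowIdx T)]
  exact Finset.sum_le_sum fun j _ => card_col_lt_le T f hf i j

/-- A filling whose columns have distinct entries and whose content is the shape differs from the
filling by row indices by a permutation of the letters within the columns. -/
theorem exists_perm_of_injective_on_columns {p : n.Partition} (T : Tableau p) (f : Fin n → ℕ)
    (hf : ∀ k k', colIdx T k = colIdx T k' → f k = f k' → k = k')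
    (hc : ∀ i, (Finset.univ.filter fun k => f k < i).card =
      (Finset.univ.filter fun k => rowIdx T k < i).card) :
    ∃ q : Perm (Fin n), (∀ k, colIdx T (q k) = colIdx T k) ∧ ∀ k, rowIdx T (q k) = f k := by
  have key : ∀ k, f k < (diagram p).colLen (colIdx T k) := by
    intro k
    set j := colIdx T k with hj
    set i := (diagram p).colLen j with hi
    have h1 := hc i
    rw [card_filter_lt_eq_sum_col T f, card_filter_lt_eq_sum_col T (rowIdx T)] at h1
    have h2 := (Finset.sum_eq_sum_iff_of_le
      (fun j _ => card_col_lt_le T f hf i j)).1 h1 j (by simp [hj])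
    -- every letter of the column has row index `< i`, hence an entry `< i`
    have h3 : (Finset.univ.filter fun k => colIdx T k = j ∧ rowIdx T k < i) =
        Finset.univ.filter fun k => colIdx T k = j := by
      refine Finset.filter_congr fun k' _ => and_iff_left_of_imp fun e => ?_
      rw [hi, ← e]
      exact rowIdx_lt_colLen T k'
    have h4 : (Finset.univ.filter fun k => colIdx T k = j ∧ f k < i) =
        Finset.univ.filter fun k => colIdx T k = j := by
      refine Finset.eq_of_subset_of_card_le (fun k' hk' => ?_) (by rw [h2, h3])
      simp only [Finset.mem_filter, Finset.mem_univ, true_and] at hk' ⊢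
      exact hk'.1
    have h5 : k ∈ Finset.univ.filter fun k => colIdx T k = j ∧ f k < i := by
      rw [h4]; simp [hj]
    simpa using (Finset.mem_filter.1 h5).2.2
  choose q hq1 hq2 using fun k => exists_letter T (key k)
  have hinj : Function.Injective q := by
    intro k k' e
    refine hf k k' ?_ ?_
    · rw [← hq2 k, ← hq2 k', e]
    · rw [← hq1 k, ← hq1 k', e]
  exact ⟨Equiv.ofBijective q (Finite.injective_iff_bijective.1 hinj), hq2, hq1⟩

/-! ### Symmetrizers of colourings -/

section Symmetrizer

variable {ι κ : Type*}

open Classical in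
/-- The permutations of the letters that preserve the colouring `f`. -/
def stab (f : Fin n → ι) : Finset (Perm (Fin n)) := Finset.univ.filter fun σ => f ∘ σ = f

theorem mem_stab {f : Fin n → ι} {σ : Perm (Fin n)} : σ ∈ stab f ↔ f ∘ σ = f := by
  simp [stab]

theorem one_mem_stab (f : Fin n → ι) : 1 ∈ stab f := mem_stab.2 rfl

/-- The sum in `ℂ[S_n]` of the permutations that preserve the colouring `f`. -/
def symmetrizer (f : Fin n → ι) : MonoidAlgebra ℂ (Perm (Fin n)) :=
  ∑ σ ∈ stab f, MonoidAlgebra.single σ (1 : ℂ)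

/-- The signed sum in `ℂ[S_n]` of the permutations that preserve the colouring `f`. -/
def antisymmetrizer (f : Fin n → ι) : MonoidAlgebra ℂ (Perm (Fin n)) :=
  ∑ σ ∈ stab f, MonoidAlgebra.single σ (((Perm.sign σ : ℤ) : ℂ))

theorem mul_mem_stab_iff {f : Fin n → ι} {σ τ : Perm (Fin n)} (h : σ ∈ stab f) :
    σ * τ ∈ stab f ↔ τ ∈ stab f := by
  rw [mem_stab] at h
  rw [mem_stab, mem_stab, Perm.coe_mul, ← Function.comp_assoc, h]

theorem mem_stab_mul_iff {f : Fin n → ι} {σ τ : Perm (Fin n)} (h : σ ∈ stab f) :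
    τ * σ ∈ stab f ↔ τ ∈ stab f := by
  rw [mem_stab] at h
  rw [mem_stab, mem_stab, Perm.coe_mul]
  constructor
  · intro e
    have : (f ∘ τ) ∘ σ = f ∘ σ := by rw [Function.comp_assoc, e, h]
    exact σ.surjective.injective_comp_right this
  · intro e
    rw [← Function.comp_assoc, e, h]

theorem single_mul_symmetrizer {f : Fin n → ι} {σ : Perm (Fin n)} (h : σ ∈ stab f) :
    MonoidAlgebra.single σ 1 * symmetrizer f = symmetrizer f := by
  unfold symmetrizer
  rw [Finset.mul_sum]
  refine Finset.sum_equiv (Equiv.mulLeft σ) (fun τ => ?_) fun τ _ => ?_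
  · rw [Equiv.coe_mulLeft, mul_mem_stab_iff h]
  · simp

theorem symmetrizer_mul_single {f : Fin n → ι} {σ : Perm (Fin n)} (h : σ ∈ stab f) :
    symmetrizer f * MonoidAlgebra.single σ 1 = symmetrizer f := by
  unfold symmetrizer
  rw [Finset.sum_mul]
  refine Finset.sum_equiv (Equiv.mulRight σ) (fun τ => ?_) fun τ _ => ?_
  · rw [Equiv.coe_mulRight, mem_stab_mul_iff h]
  · simp

theorem single_mul_antisymmetrizer {f : Fin n → ι} {σ : Perm (Fin n)} (h : σ ∈ stab f) :
    MonoidAlgebra.single σ 1 * antisymmetrizer f =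
      ((Perm.sign σ : ℤ) : ℂ) • antisymmetrizer f := by
  unfold antisymmetrizer
  rw [Finset.mul_sum, Finset.smul_sum]
  refine Finset.sum_equiv (Equiv.mulLeft σ) (fun τ => ?_) fun τ _ => ?_
  · rw [Equiv.coe_mulLeft, mul_mem_stab_iff h]
  · rw [MonoidAlgebra.single_mul_single, Equiv.coe_mulLeft, MonoidAlgebra.smul_single,
      Perm.sign_mul, smul_eq_mul, one_mul, Units.val_mul, Int.cast_mul, ← mul_assoc,
      ← Int.cast_mul, ← Units.val_mul, Int.units_mul_self, Units.val_one, Int.cast_one, one_mul]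

/-- Conjugating the symmetrizer of `f` gives the symmetrizer of the permuted colouring. -/
theorem symmetrizer_mul_single_eq (f : Fin n → ι) (h : Perm (Fin n)) :
    symmetrizer f * MonoidAlgebra.single h 1 =
      MonoidAlgebra.single h 1 * symmetrizer (f ∘ h) := by
  unfold symmetrizer
  rw [Finset.mul_sum, Finset.sum_mul]
  refine Finset.sum_equiv (MulAut.conj h⁻¹).toEquiv (fun τ => ?_) fun τ _ => ?_
  · simp only [MulEquiv.toEquiv_eq_coe, EquivLike.coe_coe, MulAut.conj_apply, mem_stab, inv_inv]
    have : (f ∘ h) ∘ (h⁻¹ * τ * h : Perm (Fin n)) = (f ∘ τ) ∘ h := by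
      ext k; simp
    rw [this]
    exact h.surjective.injective_comp_right.eq_iff.symm
  · simp [mul_assoc]

theorem swap_mem_stab {f : Fin n → ι} {i j : Fin n} (h : f i = f j) : swap i j ∈ stab f := by
  rw [mem_stab]
  ext k
  simp only [Function.comp_apply]
  rcases eq_or_ne k i with rfl | hi
  · rw [swap_apply_left, h]
  rcases eq_or_ne k j with rfl | hj
  · rw [swap_apply_right, h]
  rw [swap_apply_of_ne_of_ne hi hj]

/-- Two letters of the same colour under both `f` and `g` kill the product of the symmetrizer of
`f` and the antisymmetrizer of `g`, as their transposition acts by `1` and by `-1`. -/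
theorem symmetrizer_mul_antisymmetrizer_eq_zero {f : Fin n → ι} {g : Fin n → κ} {i j : Fin n}
    (hij : i ≠ j) (hf : f i = f j) (hg : g i = g j) :
    symmetrizer f * antisymmetrizer g = 0 := by
  have h : symmetrizer f * antisymmetrizer g = -(symmetrizer f * antisymmetrizer g) := by
    conv_lhs => rw [← symmetrizer_mul_single (swap_mem_stab hf), mul_assoc,
      single_mul_antisymmetrizer (swap_mem_stab hg), Perm.sign_swap hij]
    simp
  have h2 : (2 : ℂ) • (symmetrizer f * antisymmetrizer g) = 0 := by
    rw [two_smul]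
    nth_rw 2 [h]
    exact add_neg_cancel _
  exact (smul_eq_zero.1 h2).resolve_left two_ne_zero

theorem symmetrizer_mul_self (f : Fin n → ι) :
    symmetrizer f * symmetrizer f = ((stab f).card : ℂ) • symmetrizer f := by
  conv_lhs => enter [1]; unfold symmetrizer
  rw [Finset.sum_mul, Finset.sum_congr rfl fun σ h => single_mul_symmetrizer h, Finset.sum_const,
    Nat.cast_smul_eq_nsmul]

end Symmetrizer

/-! ### Young symmetrizers -/

section Young

variable {p : n.Partition} (T : Tableau p)

theorem mem_stab_rowIdx {σ : Perm (Fin n)} :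
    σ ∈ stab (rowIdx T) ↔ ∀ k, rowIdx T (σ k) = rowIdx T k := by
  rw [mem_stab, funext_iff]; rfl

theorem mem_stab_colIdx {σ : Perm (Fin n)} :
    σ ∈ stab (colIdx T) ↔ ∀ k, colIdx T (σ k) = colIdx T k := by
  rw [mem_stab, funext_iff]; rfl

theorem youngSymmetrizer_eq :
    youngSymmetrizer T = symmetrizer (rowIdx T) * antisymmetrizer (colIdx T) := by
  have h1 : rowSymmetrizer T = symmetrizer (rowIdx T) := by
    unfold rowSymmetrizer symmetrizer
    refine Finset.sum_congr ?_ fun _ _ => rfl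
    ext σ
    rw [mem_stab_rowIdx]
    simp only [Finset.mem_filter, Finset.mem_univ, true_and]
    exact Iff.rfl
  have h2 : colSymmetrizer T = antisymmetrizer (colIdx T) := by
    unfold colSymmetrizer antisymmetrizer
    refine Finset.sum_congr ?_ fun _ _ => rfl
    ext σ
    rw [mem_stab_colIdx]
    simp only [Finset.mem_filter, Finset.mem_univ, true_and]
    exact Iff.rfl
  rw [youngSymmetrizer, h1, h2]

theorem coeff_one_youngSymmetrizer : (youngSymmetrizer T).coeff 1 = 1 := by
  rw [youngSymmetrizer_eq, symmetrizer, antisymmetrizer, Finset.sum_mul_sum]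
  simp only [MonoidAlgebra.single_mul_single, MonoidAlgebra.coeff_sum, Finsupp.finsetSum_apply,
    MonoidAlgebra.coeff_single, Finsupp.single_apply]
  rw [Finset.sum_eq_single_of_mem 1 (one_mem_stab _), Finset.sum_eq_single_of_mem 1 (one_mem_stab _)]
  · simp
  · intro q hq hq1
    rw [if_neg (by simpa using hq1)]
  · intro r hr hr1
    refine Finset.sum_eq_zero fun q hq => if_neg fun e => hr1 ?_
    have hq' : q = r⁻¹ := (inv_eq_of_mul_eq_one_right e).symm
    rw [mem_stab_rowIdx] at hr
    rw [mem_stab_colIdx] at hq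
    ext1 k
    refine eq_of_rowIdx_eq_of_colIdx_eq T (hr k) ?_
    rw [← hq (r k), hq']
    simp

/-- The sandwich `a y b` of the row symmetrizer `a` and the column antisymmetrizer `b` is a multiple
of the Young symmetrizer `a b`. For a permutation `y` that is not the product of a row and a column
permutation, two letters of one column end up in one row, and the sandwich vanishes. -/
theorem exists_symmetrizer_mul_mul_antisymmetrizer (y : MonoidAlgebra ℂ (Perm (Fin n))) :
    ∃ t : ℂ, symmetrizer (rowIdx T) * y * antisymmetrizer (colIdx T) = t • youngSymmetrizer T := by
  induction y using MonoidAlgebra.induction_linear with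
  | zero => exact ⟨0, by simp⟩
  | add x y hx hy =>
    obtain ⟨s, hs⟩ := hx
    obtain ⟨t, ht⟩ := hy
    exact ⟨s + t, by rw [mul_add, add_mul, hs, ht, add_smul]⟩
  | single h r =>
    have hr : MonoidAlgebra.single h r = r • MonoidAlgebra.single h (1 : ℂ) := by simp
    rw [hr, mul_smul_comm, smul_mul_assoc]
    suffices ∃ t : ℂ, symmetrizer (rowIdx T) * MonoidAlgebra.single h 1 *
        antisymmetrizer (colIdx T) = t • youngSymmetrizer T by
      obtain ⟨t, ht⟩ := this
      exact ⟨r * t, by rw [ht, smul_smul]⟩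
    by_cases hf : ∀ k k', colIdx T k = colIdx T k' → rowIdx T (h k) = rowIdx T (h k') → k = k'
    · obtain ⟨q, hq1, hq2⟩ := exists_perm_of_injective_on_columns T (rowIdx T ∘ h) hf (fun i => by
        refine Finset.card_equiv h fun k => ?_
        simp)
      have hr : h * q⁻¹ ∈ stab (rowIdx T) := by
        rw [mem_stab_rowIdx]
        intro k
        have := hq2 (q⁻¹ k)
        simpa using this.symm
      refine ⟨((Perm.sign q : ℤ) : ℂ), ?_⟩
      have hh : MonoidAlgebra.single h (1 : ℂ) =
          MonoidAlgebra.single (h * q⁻¹) 1 * MonoidAlgebra.single q 1 := by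
        simp
      rw [hh, ← mul_assoc, symmetrizer_mul_single hr, mul_assoc,
        single_mul_antisymmetrizer ((mem_stab_colIdx T).2 hq1), mul_smul_comm, youngSymmetrizer_eq]
    · push Not at hf
      obtain ⟨k, k', h1, h2, h3⟩ := hf
      refine ⟨0, ?_⟩
      rw [symmetrizer_mul_single_eq, mul_assoc,
        symmetrizer_mul_antisymmetrizer_eq_zero (f := rowIdx T ∘ h) h3 h2 h1, mul_zero, zero_smul]

end Young

/-! ### Traces on the group algebra -/

section Trace

/-- A linear map with values in the line spanned by `c` and with `L c = s • c` has trace `s`. -/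
theorem trace_eq_of_forall_exists_smul {V : Type*} [AddCommGroup V] [Module ℂ V]
    [FiniteDimensional ℂ V] (L : V →ₗ[ℂ] V) (ℓ : V →ₗ[ℂ] ℂ) {c : V} {s : ℂ} (hc : ℓ c = 1)
    (hL : ∀ y, ∃ t : ℂ, L y = t • c) (hs : L c = s • c) : LinearMap.trace ℂ V L = s := by
  have h : L = (ℓ ∘ₗ L).smulRight c := by
    ext y
    obtain ⟨t, ht⟩ := hL y
    simp [ht, hc]
  rw [h, LinearMap.trace_smulRight, LinearMap.comp_apply, hs, map_smul, hc, smul_eq_mul, mul_one]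

variable {G : Type*} [Group G]

/-- The trace of `y ↦ x * y * c` on the group algebra. -/
def sandwichTrace (c : MonoidAlgebra ℂ G) : MonoidAlgebra ℂ G →ₗ[ℂ] ℂ where
  toFun x := LinearMap.trace ℂ (MonoidAlgebra ℂ G)
    (LinearMap.mulLeft ℂ x * LinearMap.mulRight ℂ c)
  map_add' x y := by
    rw [← map_add, ← add_mul]
    congr 2
    exact LinearMap.ext fun z => by simp [add_mul]
  map_smul' r x := by
    rw [RingHom.id_apply, ← map_smul, ← smul_mul_assoc]
    congr 2
    exact LinearMap.ext fun z => by simp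

theorem sandwichTrace_apply (c x : MonoidAlgebra ℂ G) :
    sandwichTrace c x = LinearMap.trace ℂ (MonoidAlgebra ℂ G)
      (LinearMap.mulLeft ℂ x * LinearMap.mulRight ℂ c) := rfl

instance {G : Type*} [Finite G] : FiniteDimensional ℂ (MonoidAlgebra ℂ G) :=
  Module.Finite.equiv (MonoidAlgebra.coeffLinearEquiv ℂ).symm

theorem trace_monoidAlgebra {G : Type*} [Fintype G]
    (L : MonoidAlgebra ℂ G →ₗ[ℂ] MonoidAlgebra ℂ G) :
    LinearMap.trace ℂ _ L = ∑ h : G, (L (MonoidAlgebra.single h 1)).coeff h := by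
  classical
  let b : Module.Basis G ℂ (MonoidAlgebra ℂ G) := ⟨MonoidAlgebra.coeffLinearEquiv ℂ⟩
  rw [LinearMap.trace_eq_matrix_trace ℂ b, Matrix.trace]
  refine Finset.sum_congr rfl fun h _ => ?_
  rw [Matrix.diag_apply, LinearMap.toMatrix_apply]
  rfl

theorem sandwichTrace_single [Fintype G] (c : MonoidAlgebra ℂ G) (g : G) :
    sandwichTrace c (MonoidAlgebra.single g 1) = ∑ h : G, c.coeff (h⁻¹ * g⁻¹ * h) := by
  rw [sandwichTrace_apply, trace_monoidAlgebra]
  refine Finset.sum_congr rfl fun h _ => ?_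
  simp only [Module.End.mul_apply, LinearMap.mulRight_apply, LinearMap.mulLeft_apply, ← mul_assoc]
  rw [MonoidAlgebra.single_mul_single, mul_one]
  have := MonoidAlgebra.coeff_single_mul_eq_mul_coeff (x := c) (r := (1 : ℂ)) (m := g * h)
    (m₁ := h) (h⁻¹ * g⁻¹ * h) (fun m' _ => by
      constructor
      · intro e
        rw [eq_inv_mul_of_mul_eq e]; simp [mul_assoc]
      · rintro rfl
        simp [mul_assoc])
  rw [this, one_mul]

theorem sandwichTrace_eq_sum [Fintype G] (c x : MonoidAlgebra ℂ G) :
    sandwichTrace c x = ∑ g, x.coeff g * sandwichTrace c (MonoidAlgebra.single g 1) := by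
  induction x using MonoidAlgebra.induction_linear with
  | zero => simp
  | add x y hx hy => simp [hx, hy, add_mul, Finset.sum_add_distrib]
  | single h r =>
    classical
    have hr : MonoidAlgebra.single h r = r • MonoidAlgebra.single h (1 : ℂ) := by simp
    conv_lhs => rw [hr, map_smul]
    simp [Finsupp.single_apply]

theorem sandwichTrace_conj (c x : MonoidAlgebra ℂ G) (h : G) :
    sandwichTrace c (MonoidAlgebra.single h⁻¹ 1 * x * MonoidAlgebra.single h 1) =
      sandwichTrace c x := by
  rw [sandwichTrace_apply, sandwichTrace_apply, mul_assoc, LinearMap.mulLeft_mul]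
  change LinearMap.trace ℂ _ ((LinearMap.mulLeft ℂ (MonoidAlgebra.single h⁻¹ 1) *
    LinearMap.mulLeft ℂ (x * MonoidAlgebra.single h 1)) * LinearMap.mulRight ℂ c) = _
  rw [mul_assoc, LinearMap.trace_mul_comm]
  congr 1
  refine LinearMap.ext fun y => ?_
  simp only [Module.End.mul_apply, LinearMap.mulRight_apply, LinearMap.mulLeft_apply]
  have h1 : MonoidAlgebra.single h (1 : ℂ) * MonoidAlgebra.single h⁻¹ 1 = 1 := by
    simp [MonoidAlgebra.one_def]
  rw [mul_assoc x, mul_assoc _ y c, ← mul_assoc _ _ (y * c), h1, one_mul]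

/-- The trace of left multiplication by `x` on the left ideal generated by a quasi-idempotent. -/
theorem mul_trace_span_singleton [Finite G] {c : MonoidAlgebra ℂ G} {κ : ℂ}
    (hc : c * c = κ • c) (x : MonoidAlgebra ℂ G) :
    κ * LinearMap.trace ℂ (Ideal.span {c})
      (Algebra.lsmul ℂ ℂ (Ideal.span {c} : Ideal (MonoidAlgebra ℂ G)) x) = sandwichTrace c x := by
  let I : Ideal (MonoidAlgebra ℂ G) := Ideal.span {c}
  let P : MonoidAlgebra ℂ G →ₗ[ℂ] I :=
    (LinearMap.mulRight ℂ c).codRestrict (I.restrictScalars ℂ)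
      (fun y => I.mul_mem_left y (Ideal.subset_span rfl))
  let ι : I →ₗ[ℂ] MonoidAlgebra ℂ G := (I.restrictScalars ℂ).subtype
  have h1 : sandwichTrace c x = LinearMap.trace ℂ _ (LinearMap.mulLeft ℂ x ∘ₗ (ι ∘ₗ P)) := rfl
  have h2 : P ∘ₗ (LinearMap.mulLeft ℂ x ∘ₗ ι) = κ • (Algebra.lsmul ℂ ℂ I x : I →ₗ[ℂ] I) := by
    ext1 ⟨y, hy⟩
    obtain ⟨z, rfl⟩ := Ideal.mem_span_singleton'.1 hy
    refine Subtype.ext ?_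
    change x * (z * c) * c = κ • (x * (z * c))
    simp only [mul_assoc, hc, mul_smul_comm]
  rw [h1, ← LinearMap.comp_assoc, LinearMap.trace_comp_comm', h2, map_smul, smul_eq_mul]

end Trace

/-! ### The character of the Specht module -/

section SpechtCharacter

variable {p : n.Partition} (T : Tableau p)

theorem youngSymmetrizer_mul_self_ne_zero : youngSymmetrizer T * youngSymmetrizer T ≠ 0 := by
  intro h
  have h1 : IsNilpotent (LinearMap.mulRight ℂ (youngSymmetrizer T)) := by
    refine ⟨2, LinearMap.ext fun y => ?_⟩
    simp [pow_two, mul_assoc, h]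
  have h2 := (LinearMap.isNilpotent_trace_of_isNilpotent h1).eq_zero
  rw [trace_monoidAlgebra] at h2
  have h3 : ∀ h : Perm (Fin n), (LinearMap.mulRight ℂ (youngSymmetrizer T)
      (MonoidAlgebra.single h 1)).coeff h = 1 := by
    intro h
    rw [LinearMap.mulRight_apply, MonoidAlgebra.coeff_single_mul_eq_mul_coeff 1
      (fun m' _ => by simp), coeff_one_youngSymmetrizer, mul_one]
  rw [Finset.sum_congr rfl fun h _ => h3 h] at h2
  simp at h2

theorem exists_youngSymmetrizer_mul_self :
    ∃ κ : ℂ, κ ≠ 0 ∧ youngSymmetrizer T * youngSymmetrizer T = κ • youngSymmetrizer T := by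
  obtain ⟨κ, hκ⟩ := exists_symmetrizer_mul_mul_antisymmetrizer T
    (antisymmetrizer (colIdx T) * symmetrizer (rowIdx T))
  have h : youngSymmetrizer T * youngSymmetrizer T = κ • youngSymmetrizer T := by
    rw [← hκ, youngSymmetrizer_eq]
    simp only [mul_assoc]
  refine ⟨κ, fun h0 => youngSymmetrizer_mul_self_ne_zero T ?_, h⟩
  rw [h, h0, zero_smul]

theorem mul_character_spechtRep {κ : ℂ}
    (hc : youngSymmetrizer T * youngSymmetrizer T = κ • youngSymmetrizer T) (σ : Perm (Fin n)) :
    κ * (spechtRep T).character σ =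
      sandwichTrace (youngSymmetrizer T) (MonoidAlgebra.single σ 1) :=
  mul_trace_span_singleton hc _

theorem character_spechtRep_eq_of_isConj {σ τ : Perm (Fin n)} (h : IsConj σ τ) :
    (spechtRep T).character σ = (spechtRep T).character τ := by
  obtain ⟨g, rfl⟩ := isConj_iff.1 h
  rw [Representation.char_conj]

theorem isConj_inv_self (σ : Perm (Fin n)) : IsConj σ⁻¹ σ :=
  Perm.isConj_of_cycleType_eq (Perm.cycleType_inv σ)

/-- The irreducible character has norm `1`. -/
theorem sum_character_mul_self :
    ∑ σ, (spechtRep T).character σ * (spechtRep T).character σ = (n.factorial : ℂ) := by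
  obtain ⟨κ, hκ, hc⟩ := exists_youngSymmetrizer_mul_self T
  set c := youngSymmetrizer T with hcdef
  set χ := (spechtRep T).character with hχ
  have h1 : ∀ σ, κ * χ σ = ∑ h, c.coeff (h⁻¹ * σ * h) := by
    intro σ
    have : χ σ = χ σ⁻¹ := (character_spechtRep_eq_of_isConj T (isConj_inv_self σ)).symm
    rw [this, mul_character_spechtRep T hc, sandwichTrace_single, inv_inv]
  -- `c y c = a (b y a) b` is a multiple of `c`, so `y ↦ c y c` has rank one
  have h2 : sandwichTrace c c = κ * κ := by
    rw [sandwichTrace_apply]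
    refine trace_eq_of_forall_exists_smul _
      ((Finsupp.lapply 1) ∘ₗ (MonoidAlgebra.coeffLinearEquiv ℂ).toLinearMap) (c := c)
      (coeff_one_youngSymmetrizer T) (fun y => ?_) ?_
    · obtain ⟨t, ht⟩ := exists_symmetrizer_mul_mul_antisymmetrizer T
        (antisymmetrizer (colIdx T) * y * symmetrizer (rowIdx T))
      refine ⟨t, ?_⟩
      rw [← hcdef] at ht
      rw [← ht, Module.End.mul_apply, LinearMap.mulRight_apply, LinearMap.mulLeft_apply, hcdef,
        youngSymmetrizer_eq]
      simp only [mul_assoc]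
    · rw [Module.End.mul_apply, LinearMap.mulRight_apply, LinearMap.mulLeft_apply, hc,
        mul_smul_comm, hc, smul_smul]
  have h3 : sandwichTrace c c = ∑ σ, c.coeff σ * (κ * χ σ) := by
    rw [sandwichTrace_eq_sum]
    exact Finset.sum_congr rfl fun σ _ => by rw [mul_character_spechtRep T hc]
  have h4 : κ * ∑ σ, χ σ * χ σ = n.factorial * ∑ σ, c.coeff σ * χ σ := by
    calc κ * ∑ σ, χ σ * χ σ = ∑ σ, ∑ h, c.coeff (h⁻¹ * σ * h) * χ σ := by
          rw [Finset.mul_sum]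
          refine Finset.sum_congr rfl fun σ _ => ?_
          rw [← Finset.sum_mul, ← h1, mul_assoc]
      _ = ∑ h : Perm (Fin n), ∑ σ, c.coeff σ * χ σ := by
          rw [Finset.sum_comm]
          refine Finset.sum_congr rfl fun h _ => ?_
          refine Finset.sum_equiv (MulAut.conj h⁻¹).toEquiv (by simp) fun σ _ => ?_
          simp only [MulEquiv.toEquiv_eq_coe, EquivLike.coe_coe, MulAut.conj_apply, inv_inv]
          congr 1
          exact character_spechtRep_eq_of_isConj T (isConj_iff.2 ⟨h⁻¹, by simp⟩)
      _ = _ := by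
          rw [Finset.sum_const, Finset.card_univ, Fintype.card_perm, Fintype.card_fin, nsmul_eq_mul]
  have h5 : κ * κ = κ * ∑ σ, c.coeff σ * χ σ := by
    rw [← h2, h3, Finset.mul_sum]
    exact Finset.sum_congr rfl fun σ _ => by ring
  rw [← mul_left_cancel₀ hκ h5, mul_comm] at h4
  exact mul_right_cancel₀ hκ h4

theorem mul_sum_stab_character {ι : Type*} {κ : ℂ}
    (hc : youngSymmetrizer T * youngSymmetrizer T = κ • youngSymmetrizer T) (f : Fin n → ι) :
    κ * ∑ σ ∈ stab f, (spechtRep T).character σ =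
      sandwichTrace (youngSymmetrizer T) (symmetrizer f) := by
  rw [symmetrizer, map_sum, Finset.mul_sum]
  exact Finset.sum_congr rfl fun σ _ => mul_character_spechtRep T hc σ

/-- The Specht module has no vectors fixed by the stabilizer of a colouring whose content is not
dominated by the shape. -/
theorem sum_stab_character_eq_zero (f : Fin n → ℕ) {i : ℕ}
    (hi : (Finset.univ.filter fun k => rowIdx T k < i).card <
      (Finset.univ.filter fun k => f k < i).card) :
    ∑ σ ∈ stab f, (spechtRep T).character σ = 0 := by
  obtain ⟨κ, hκ, hc⟩ := exists_youngSymmetrizer_mul_self T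
  have h1 : ∀ y, symmetrizer f * y * antisymmetrizer (colIdx T) = 0 := by
    intro y
    induction y using MonoidAlgebra.induction_linear with
    | zero => simp
    | add x y hx hy => rw [mul_add, add_mul, hx, hy, add_zero]
    | single h r =>
      have hr : MonoidAlgebra.single h r = r • MonoidAlgebra.single h (1 : ℂ) := by simp
      rw [hr, mul_smul_comm, smul_mul_assoc, symmetrizer_mul_single_eq, mul_assoc]
      by_cases hf : ∀ k k', colIdx T k = colIdx T k' → f (h k) = f (h k') → k = k'
      · have h2 := card_lt_le_of_injective_on_columns T (f ∘ h) hf i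
        have h3 : (Finset.univ.filter fun k => (f ∘ h) k < i).card =
            (Finset.univ.filter fun k => f k < i).card :=
          Finset.card_equiv h fun k => by simp
        omega
      · push Not at hf
        obtain ⟨k, k', h1, h2, h3⟩ := hf
        rw [symmetrizer_mul_antisymmetrizer_eq_zero (f := f ∘ h) h3 h2 h1, mul_zero, smul_zero]
  -- cyclicity of the trace brings the two factors next to `y`
  have h2 : sandwichTrace (youngSymmetrizer T) (symmetrizer f) = 0 := by
    have h3 : LinearMap.mulLeft ℂ (symmetrizer f) * LinearMap.mulRight ℂ (youngSymmetrizer T) =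
        (LinearMap.mulLeft ℂ (symmetrizer f) *
          LinearMap.mulRight ℂ (antisymmetrizer (colIdx T))) *
            LinearMap.mulRight ℂ (symmetrizer (rowIdx T)) := by
      refine LinearMap.ext fun y => ?_
      simp [youngSymmetrizer_eq, mul_assoc]
    have h4 : LinearMap.mulLeft ℂ (symmetrizer f) *
        LinearMap.mulRight ℂ (antisymmetrizer (colIdx T)) = 0 := by
      refine LinearMap.ext fun y => ?_
      simpa [mul_assoc] using h1 y
    rw [sandwichTrace_apply, h3, h4, zero_mul, map_zero]
  rw [← mul_sum_stab_character T hc] at h2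
  exact (mul_eq_zero.1 h2).resolve_left hκ

/-- The stabilizer of a colouring whose content is the shape fixes a line in the Specht module. -/
theorem sum_stab_character_rowIdx_comp (h : Perm (Fin n)) :
    ∑ σ ∈ stab (rowIdx T ∘ h), (spechtRep T).character σ = ((stab (rowIdx T)).card : ℂ) := by
  obtain ⟨κ, hκ, hc⟩ := exists_youngSymmetrizer_mul_self T
  refine mul_left_cancel₀ hκ ?_
  rw [mul_sum_stab_character T hc]
  have h1 : symmetrizer (rowIdx T ∘ h) = MonoidAlgebra.single h⁻¹ 1 * symmetrizer (rowIdx T) *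
      MonoidAlgebra.single h 1 := by
    rw [mul_assoc, symmetrizer_mul_single_eq, ← mul_assoc, MonoidAlgebra.single_mul_single]
    simp [← MonoidAlgebra.one_def]
  rw [h1, sandwichTrace_conj, sandwichTrace_apply]
  have h2 : symmetrizer (rowIdx T) * youngSymmetrizer T =
      ((stab (rowIdx T)).card : ℂ) • youngSymmetrizer T := by
    rw [youngSymmetrizer_eq, ← mul_assoc, symmetrizer_mul_self, smul_mul_assoc]
  refine trace_eq_of_forall_exists_smul _
      ((Finsupp.lapply 1) ∘ₗ (MonoidAlgebra.coeffLinearEquiv ℂ).toLinearMap)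
      (coeff_one_youngSymmetrizer T) (fun y => ?_) ?_
  · obtain ⟨t, ht⟩ := exists_symmetrizer_mul_mul_antisymmetrizer T (y * symmetrizer (rowIdx T))
    refine ⟨t, ?_⟩
    rw [← ht, Module.End.mul_apply, LinearMap.mulRight_apply, LinearMap.mulLeft_apply,
      youngSymmetrizer_eq]
    simp only [mul_assoc]
  · rw [Module.End.mul_apply, LinearMap.mulRight_apply, LinearMap.mulLeft_apply, hc,
      mul_smul_comm, h2, smul_smul]

theorem map_conj_youngSymmetrizer :
    MonoidAlgebra.mapRingHom (Perm (Fin n)) (starRingEnd ℂ) (youngSymmetrizer T) =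
      youngSymmetrizer T := by
  rw [youngSymmetrizer_eq, symmetrizer, antisymmetrizer, map_mul, map_sum, map_sum]
  simp

theorem conj_coeff_youngSymmetrizer (σ : Perm (Fin n)) :
    (starRingEnd ℂ) ((youngSymmetrizer T).coeff σ) = (youngSymmetrizer T).coeff σ := by
  conv_rhs => rw [← map_conj_youngSymmetrizer]
  simp

theorem conj_character_spechtRep (σ : Perm (Fin n)) :
    (starRingEnd ℂ) ((spechtRep T).character σ) = (spechtRep T).character σ := by
  obtain ⟨κ, hκ, hc⟩ := exists_youngSymmetrizer_mul_self T
  have h1 : (starRingEnd ℂ) κ = κ := by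
    have h2 := congrArg (MonoidAlgebra.mapRingHom (Perm (Fin n)) (starRingEnd ℂ)) hc
    rw [map_mul, map_conj_youngSymmetrizer, hc] at h2
    have h3 := congrArg (fun x : MonoidAlgebra ℂ (Perm (Fin n)) => x.coeff 1) h2
    simpa [coeff_one_youngSymmetrizer] using h3.symm
  have h4 := mul_character_spechtRep T hc σ
  refine mul_left_cancel₀ hκ ?_
  conv_lhs => rw [← h1]
  rw [h4, ← map_mul, h4, sandwichTrace_single]
  simp [conj_coeff_youngSymmetrizer]

end SpechtCharacter

/-! ### Colourings fixed by a permutation -/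

section Colouring

open scoped Classical in
/-- The colourings of the letters that are constant on the cycles of `σ`. -/
def fixedColourings (ι : Type*) [Fintype ι] (σ : Perm (Fin n)) : Finset (Fin n → ι) :=
  Finset.univ.filter fun f => f ∘ σ = f

variable {ι : Type*} [Fintype ι]

theorem mem_fixedColourings {σ : Perm (Fin n)} {f : Fin n → ι} :
    f ∈ fixedColourings ι σ ↔ f ∘ σ = f := by
  simp [fixedColourings]

/-- The content of a colouring: the number of letters of each colour. -/
def content {ι : Type*} (f : Fin n → ι) : ι →₀ ℕ := ∑ k, Finsupp.single (f k) 1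

theorem content_apply {ι : Type*} [DecidableEq ι] (f : Fin n → ι) (c : ι) :
    content f c = (Finset.univ.filter fun k => f k = c).card := by
  rw [content, Finsupp.finsetSum_apply, Finset.card_filter]
  exact Finset.sum_congr rfl fun k _ => Finsupp.single_apply

theorem sum_content (f : Fin n → ι) : ∑ c, content f c = n := by
  simp_rw [content, Finsupp.finsetSum_apply]
  rw [Finset.sum_comm]
  simp

theorem exists_comp_eq_of_content_eq {ι : Type*} {f g : Fin n → ι} (h : content f = content g) :
    ∃ σ : Perm (Fin n), f ∘ σ = g := by
  classical
  have h1 : ∀ c, Nonempty ({k // g k = c} ≃ {k // f k = c}) := fun c => by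
    have h2 := DFunLike.congr_fun h c
    rw [content_apply, content_apply, ← Fintype.card_subtype, ← Fintype.card_subtype] at h2
    exact Fintype.card_eq.1 h2.symm
  let e := fun c => (h1 c).some
  exact ⟨Equiv.ofFiberEquiv e, funext fun k => Equiv.ofFiberEquiv_map e k⟩

theorem content_comp {ι : Type*} (f : Fin n → ι) (σ : Perm (Fin n)) :
    content (f ∘ σ) = content f :=
  Equiv.sum_comp σ fun k => Finsupp.single (f k) 1

theorem exists_content_eq (m : ι →₀ ℕ) (hm : ∑ c, m c = n) :
    ∃ f : Fin n → ι, content f = m := by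
  classical
  have h : (Finsupp.toMultiset m).card = n := by
    rw [Finsupp.card_toMultiset, Finsupp.sum_fintype _ _ (by simp)]
    exact hm
  obtain ⟨l, hl⟩ := Quotient.exists_rep (Finsupp.toMultiset m)
  have hl' : (l : Multiset ι) = Finsupp.toMultiset m := hl
  have hn : l.length = n := by rw [← h, ← hl', Multiset.coe_card]
  subst hn
  refine ⟨l.get, ?_⟩
  apply Function.LeftInverse.injective Finsupp.toMultiset_toFinsupp
  rw [← hl', content, map_sum]
  simp only [Finsupp.toMultiset_single, one_smul]
  conv_rhs => rw [← List.ofFn_get l, ← Fin.univ_val_map]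
  exact Multiset.bind_singleton _ _

/-- The colourings of a given content form one orbit of the symmetric group, so the orders of
their stabilizers add up to `n!`. -/
theorem sum_card_stab [DecidableEq ι] (m : ι →₀ ℕ) (hm : ∑ c, m c = n) :
    ∑ f : Fin n → ι with content f = m, (stab f).card = n.factorial := by
  classical
  obtain ⟨f₀, rfl⟩ := exists_content_eq m hm
  have h1 : (Finset.univ : Finset (Perm (Fin n))).card = n.factorial := by
    rw [Finset.card_univ, Fintype.card_perm, Fintype.card_fin]
  rw [← h1, Finset.card_eq_sum_card_fiberwise (f := fun σ : Perm (Fin n) => f₀ ∘ σ)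
    (t := Finset.univ.filter fun f : Fin n → ι => content f = content f₀)]
  · refine Finset.sum_congr rfl fun f hf => ?_
    obtain ⟨τ, hτ⟩ := exists_comp_eq_of_content_eq (Finset.mem_filter.1 hf).2.symm
    refine Finset.card_equiv (Equiv.mulLeft τ) fun σ => ?_
    rw [mem_stab, Finset.mem_filter, Equiv.coe_mulLeft, Perm.coe_mul, ← Function.comp_assoc, hτ]
    simp
  · intro σ _
    simp [content_comp]

end Colouring

/-! ### Power sums as sums over fixed colourings -/

section PowerSum

variable {α : Type*} [Fintype α] [DecidableEq α] (σ : Perm α)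

/-- The cycles of `σ`, fixed points included. -/
abbrev CycleIdx : Type _ := {c // c ∈ σ.cycleFactorsFinset} ⊕ {a // σ a = a}

/-- The cycle of `σ` that contains a given letter. -/
def cycleIdx (a : α) : CycleIdx σ :=
  if h : σ a = a then Sum.inr ⟨a, h⟩
  else Sum.inl ⟨σ.cycleOf a, Perm.cycleOf_mem_cycleFactorsFinset_iff.2 (Perm.mem_support.2 h)⟩

theorem cycleIdx_apply (a : α) : cycleIdx σ (σ a) = cycleIdx σ a := by
  by_cases h : σ a = a
  · rw [h]
  · have h' : σ (σ a) ≠ σ a := fun e => h (σ.injective e)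
    simp only [cycleIdx, h, h', dite_false]
    congr 2
    exact Perm.cycleOf_self_apply σ a

theorem cycleIdx_eq_inl {a : α} {c : {c // c ∈ σ.cycleFactorsFinset}} :
    cycleIdx σ a = Sum.inl c ↔ a ∈ c.1.support := by
  unfold cycleIdx
  split_ifs with h
  · simp only [false_iff]
    intro ha
    have := Perm.mem_cycleFactorsFinset_support_le c.2 ha
    exact Perm.mem_support.1 this h
  · rw [Sum.inl.injEq, Subtype.ext_iff]
    constructor
    · intro e
      rw [← e, Perm.mem_support_cycleOf_iff]
      exact ⟨Perm.SameCycle.refl _ _, Perm.mem_support.2 h⟩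
    · intro ha
      exact (Perm.cycle_is_cycleOf ha c.2).symm

theorem cycleIdx_eq_inr {a : α} {b : {a // σ a = a}} :
    cycleIdx σ a = Sum.inr b ↔ a = b.1 := by
  unfold cycleIdx
  split_ifs with h
  · rw [Sum.inr.injEq, Subtype.ext_iff]
  · simp only [false_iff]
    rintro rfl
    exact h b.2

theorem cycleIdx_surjective : Function.Surjective (cycleIdx σ) := by
  rintro (c | b)
  · obtain ⟨a, ha⟩ := (Perm.mem_cycleFactorsFinset_iff.1 c.2).1.nonempty_support
    exact ⟨a, (cycleIdx_eq_inl σ).2 ha⟩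
  · exact ⟨b.1, (cycleIdx_eq_inr σ).2 rfl⟩

theorem sameCycle_of_cycleIdx_eq {a b : α} (h : cycleIdx σ a = cycleIdx σ b) :
    σ.SameCycle a b := by
  rcases hc : cycleIdx σ b with c | b'
  · rw [hc, cycleIdx_eq_inl] at h
    rw [cycleIdx_eq_inl] at hc
    have h1 := Perm.cycle_is_cycleOf h c.2
    rw [h1] at hc
    exact (Perm.mem_support_cycleOf_iff.1 hc).1
  · rw [hc, cycleIdx_eq_inr] at h
    rw [cycleIdx_eq_inr] at hc
    rw [h, hc]

theorem apply_eq_of_sameCycle {α : Type*} [Finite α] (σ : Perm α) {ι : Type*} {f : α → ι} (hf : f ∘ σ = f) {a b : α}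
    (h : σ.SameCycle a b) : f a = f b := by
  obtain ⟨i, rfl⟩ := h.exists_nat_pow_eq
  clear h
  induction i with
  | zero => simp
  | succ i ih => rw [ih, pow_succ', Perm.mul_apply]; exact (congrFun hf _).symm

theorem prod_cycleIdx {R : Type*} [CommRing R] (y : ℕ → R) :
    ∏ o : CycleIdx σ, y (Finset.univ.filter fun a => cycleIdx σ a = o).card =
      (σ.partition.parts.map y).prod := by
  rw [Fintype.prod_sum_type, Perm.parts_partition, Multiset.map_add, Multiset.prod_add,
    Multiset.map_replicate, Multiset.prod_replicate]
  congr 1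
  · simp only [cycleIdx_eq_inl, Finset.filter_univ_mem]
    rw [Perm.cycleType_def, Multiset.map_map, Finset.prod_coe_sort σ.cycleFactorsFinset
      (fun c => y c.support.card)]
    rfl
  · simp only [cycleIdx_eq_inr, Finset.filter_eq', Finset.mem_univ, if_true,
      Finset.card_singleton, Finset.prod_const, Finset.card_univ]
    congr 1
    rw [Fintype.card_subtype, ← Finset.card_compl]
    congr 1
    ext a
    simp

/-- A power sum product, evaluated at `x`, is a sum over the colourings fixed by a permutation of
the given cycle type. -/
theorem sum_fixedColourings_prod {ι R : Type*} [Fintype ι] [CommRing R] (σ : Perm (Fin n))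
    (x : ι → R) :
    ∑ f ∈ fixedColourings ι σ, ∏ k, x (f k) =
      (σ.partition.parts.map fun r => ∑ i, x i ^ r).prod := by
  classical
  rw [← prod_cycleIdx, Finset.prod_univ_sum, Fintype.piFinset_univ]
  symm
  refine Finset.sum_bij (fun g _ => g ∘ cycleIdx σ) ?_ ?_ ?_ ?_
  · intro g _
    rw [mem_fixedColourings]
    ext a
    simp [cycleIdx_apply]
  · intro g _ g' _ e
    exact (cycleIdx_surjective σ).injective_comp_right e
  · intro f hf
    rw [mem_fixedColourings] at hf
    refine ⟨f ∘ Function.surjInv (cycleIdx_surjective σ), Finset.mem_univ _, ?_⟩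
    ext a
    refine apply_eq_of_sameCycle σ hf (sameCycle_of_cycleIdx_eq σ ?_)
    exact Function.surjInv_eq _ _
  · intro g _
    rw [← Finset.prod_fiberwise (s := Finset.univ) (g := cycleIdx σ)]
    refine Finset.prod_congr rfl fun o _ => ?_
    rw [Finset.prod_congr rfl fun a ha => ?_, Finset.prod_const]
    rw [Function.comp_apply, (Finset.mem_filter.1 ha).2]

end PowerSum

/-! ### The Cauchy determinant -/

section Cauchy

open Matrix Finset

variable {R : Type*} [CommRing R] {l : ℕ}

/-- The alternant `∏_{i < j} (x i - x j) = det (x i ^ (l - 1 - j))`. -/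
def alternant (x : Fin l → R) : R := (projVandermonde 1 x).det

theorem det_projVandermonde_one_mul (x y : Fin l → R) :
    (projVandermonde x 1).det * (projVandermonde y 1).det = alternant x * alternant y := by
  simp only [alternant, det_projVandermonde, ← Finset.prod_mul_distrib]
  refine Finset.prod_congr rfl fun i _ => Finset.prod_congr rfl fun j _ => ?_
  simp only [Pi.one_apply]
  ring

theorem prod_erase_eq_sum (y : Fin l → R) (v w : R) (j : Fin l) :
    ∏ k ∈ univ.erase j, (w - v * y k) =
      ∑ m : Fin l, v ^ m.1 * w ^ m.rev.1 *
        ∑ t ∈ powersetCard m.1 (univ.erase j), ∏ k ∈ t, -y k := by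
  have hcard : (univ.erase j : Finset (Fin l)).card + 1 = l := by
    rw [card_erase_add_one (mem_univ j), card_univ, Fintype.card_fin]
  have h1 : ∀ k, w - v * y k = v * (-y k) + w := fun k => by ring
  simp only [h1]
  rw [prod_add, sum_powerset, hcard, ← Fin.sum_univ_eq_sum_range
    (fun m => ∑ t ∈ powersetCard m (univ.erase j), (∏ i ∈ t, v * -y i) * ∏ i ∈ univ.erase j \ t, w)]
  refine sum_congr rfl fun m _ => ?_
  rw [mul_sum]
  refine sum_congr rfl fun t ht => ?_
  obtain ⟨ht1, ht2⟩ := mem_powersetCard.1 ht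
  rw [prod_mul_distrib, prod_const, prod_const, card_sdiff_of_subset ht1, ht2]
  have : (univ.erase j : Finset (Fin l)).card - m.1 = m.rev.1 := by
    rw [Fin.val_rev]; omega
  rw [this]
  ring

theorem prod_prod_erase_sub (y : Fin l → R) :
    ∏ j, ∏ k ∈ univ.erase j, (y j - y k) =
      (projVandermonde 1 y).det * (projVandermonde y 1).det := by
  simp only [det_projVandermonde, Pi.one_apply, one_mul, mul_one]
  have h1 : ∀ j : Fin l, univ.erase j = Iio j ∪ Ioi j := by
    intro j; ext k; simp [lt_or_lt_iff_ne]
  have h2 : ∀ j : Fin l, Disjoint (Iio j) (Ioi j) := fun j => by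
    rw [Finset.disjoint_left]; intro k; simp only [mem_Iio, mem_Ioi]; exact fun a b => lt_asymm a b
  simp_rw [h1, prod_union (h2 _), prod_mul_distrib]
  rw [mul_comm]
  congr 1
  exact prod_comm' (by simp)

/-- **Cauchy's determinant**: `det (1 / (1 - x i * y j))`. -/
theorem det_cauchy [IsDomain R] (x y : Fin l → R) (hy : Function.Injective y)
    (u : Fin l → Fin l → R) (hu : ∀ i j, u i j * (1 - x i * y j) = 1) :
    (Matrix.of u).det = alternant x * alternant y * ∏ i, ∏ j, u i j := by
  -- column `j` of `C` holds the coefficients of `∏ k ≠ j, (w - v * y k)`, which is evaluated at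
  -- `(v, w) = (x i, 1)` and, to find `det C` from a diagonal matrix, at `(v, w) = (1, y i)`
  let C : Matrix (Fin l) (Fin l) R := Matrix.of fun m j =>
    ∑ t ∈ powersetCard m.1 (univ.erase j), ∏ k ∈ t, -y k
  have h1 : projVandermonde x 1 * C = Matrix.of fun i j => ∏ k ∈ univ.erase j, (1 - x i * y k) := by
    ext i j
    rw [Matrix.mul_apply, Matrix.of_apply, prod_erase_eq_sum]
    rfl
  have h2 : projVandermonde 1 y * C = Matrix.diagonal fun j => ∏ k ∈ univ.erase j, (y j - y k) := by
    ext i j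
    have h3 := prod_erase_eq_sum y 1 (y i) j
    rw [Matrix.mul_apply]
    refine h3.symm.trans ?_
    simp only [one_mul]
    rcases eq_or_ne i j with rfl | hij
    · rw [Matrix.diagonal_apply_eq]
    · rw [Matrix.diagonal_apply_ne _ hij]
      exact prod_eq_zero (mem_erase.2 ⟨hij, mem_univ i⟩) (sub_self _)
  have h3 : C.det = (projVandermonde y 1).det := by
    have h4 := congrArg Matrix.det h2
    rw [Matrix.det_mul, Matrix.det_diagonal, prod_prod_erase_sub] at h4
    refine mul_left_cancel₀ ?_ h4
    rw [det_projVandermonde]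
    refine prod_ne_zero_iff.2 fun i _ => prod_ne_zero_iff.2 fun j hj => ?_
    simp only [Pi.one_apply, one_mul]
    exact sub_ne_zero.2 fun e => (mem_Ioi.1 hj).ne (hy e)
  have h4 : (Matrix.of u).det = (∏ i, ∏ j, u i j) *
      (Matrix.of fun i j => ∏ k ∈ univ.erase j, (1 - x i * y k)).det := by
    rw [← Matrix.det_mul_column]
    congr 1
    ext i j
    simp only [Matrix.of_apply]
    rw [← mul_prod_erase univ (u i) (mem_univ j), mul_assoc, ← prod_mul_distrib]
    simp [hu]
  rw [h4, ← h1, Matrix.det_mul, h3, det_projVandermonde_one_mul, mul_comm]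

theorem mk_pow_mul_one_sub (a : R) :
    (PowerSeries.mk fun k => a ^ k) * (1 - PowerSeries.X * PowerSeries.C a) = 1 := by
  ext k
  rw [mul_sub, mul_one, mul_comm PowerSeries.X, ← mul_assoc, map_sub, PowerSeries.coeff_mk]
  cases k with
  | zero => simp
  | succ k =>
    rw [PowerSeries.coeff_succ_mul_X, PowerSeries.coeff_mul_C, PowerSeries.coeff_mk, pow_succ,
      sub_self, PowerSeries.coeff_one, if_neg (Nat.succ_ne_zero k)]

/-- The homogeneous component of Cauchy's determinant: the alternants times the complete symmetric
polynomial `h_n` of the products `x i * y j`. -/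
theorem alternant_mul_alternant_mul_sum [IsDomain R] (x y : Fin l → R)
    (hy : Function.Injective y) (n : ℕ) :
    alternant x * alternant y *
        ∑ m ∈ finsuppAntidiag (univ : Finset (Fin l × Fin l)) n, ∏ c, (x c.1 * y c.2) ^ m c =
      ∑ w : Perm (Fin l), ((Perm.sign w : ℤ) : R) *
        ∑ m ∈ finsuppAntidiag (univ : Finset (Fin l)) (n + ∑ i : Fin l, i.rev.1),
          ∏ i, (x (w i) * y i) ^ m i := by
  -- Cauchy's determinant for `T * x i` and `y j`, as power series in `T`
  have h := det_cauchy (R := PowerSeries R) (fun i => PowerSeries.X * PowerSeries.C (x i))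
    (fun j => PowerSeries.C (y j)) (fun i j e => hy (PowerSeries.C_injective e))
    (fun i j => PowerSeries.mk fun k => (x i * y j) ^ k) (fun i j => by
      rw [mul_assoc, ← map_mul]; exact mk_pow_mul_one_sub _)
  have h1 : alternant (fun j => PowerSeries.C (y j)) = PowerSeries.C (alternant y) := by
    rw [alternant, alternant, RingHom.map_det]
    congr 1
    ext i j : 2
    simp [projVandermonde_apply]
  have h2 : alternant (fun i => PowerSeries.X * PowerSeries.C (x i)) =
      PowerSeries.X ^ (∑ i : Fin l, i.rev.1) * PowerSeries.C (alternant x) := by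
    rw [alternant, alternant, RingHom.map_det, ← prod_pow_eq_pow_sum, ← Matrix.det_mul_row]
    congr 1
    ext i j : 2
    simp [projVandermonde_apply, mul_pow]
  rw [h1, h2, Matrix.det_apply'] at h
  have h3 := congrArg (PowerSeries.coeff (n + ∑ i : Fin l, i.rev.1)) h
  rw [mul_assoc, mul_assoc, ← mul_assoc (PowerSeries.C _), ← map_mul,
    PowerSeries.coeff_X_pow_mul, PowerSeries.coeff_C_mul, ← Fintype.prod_prod_type' (f := fun i j =>
      PowerSeries.mk fun k => (x i * y j) ^ k), PowerSeries.coeff_prod] at h3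
  simp only [PowerSeries.coeff_mk] at h3
  rw [← h3, map_sum]
  refine sum_congr rfl fun w _ => ?_
  have h4 : (((Perm.sign w : ℤ)) : PowerSeries R) = PowerSeries.C (((Perm.sign w : ℤ)) : R) := by
    simp
  rw [h4, PowerSeries.coeff_C_mul, PowerSeries.coeff_prod]
  simp [PowerSeries.coeff_mk]

end Cauchy

/-! ### The Frobenius coefficients -/

section FrobeniusCoefficient

open MvPolynomial

theorem map_alternant {F R S : Type*} [CommRing R] [CommRing S] [FunLike F R S]
    [RingHomClass F R S] {l : ℕ} (φ : F) (x : Fin l → R) :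
    φ (alternant x) = alternant fun i => φ (x i) := by
  simp [alternant, Matrix.det_projVandermonde]

theorem mem_stab_iff_mem_fixedColourings {ι : Type*} [Fintype ι] {σ : Perm (Fin n)}
    {f : Fin n → ι} : f ∈ fixedColourings ι σ ↔ σ ∈ stab f := by
  rw [mem_stab, mem_fixedColourings]

theorem sum_sum_fixedColourings {ι A : Type*} [Fintype ι] [AddCommMonoid A]
    (F : Perm (Fin n) → (Fin n → ι) → A) :
    ∑ σ, ∑ f ∈ fixedColourings ι σ, F σ f = ∑ f, ∑ σ ∈ stab f, F σ f :=
  Finset.sum_comm' fun σ f => by simp [mem_stab_iff_mem_fixedColourings]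

/-- The cycle index sum of the symmetric group, evaluated at power sums, is `n!` times the complete
homogeneous symmetric polynomial. -/
theorem sum_sum_fixedColourings_prod {ι R : Type*} [Fintype ι] [DecidableEq ι] [CommRing R]
    (z : ι → R) :
    ∑ σ : Perm (Fin n), ∑ f ∈ fixedColourings ι σ, ∏ k, z (f k) =
      n.factorial * ∑ m ∈ Finset.finsuppAntidiag (Finset.univ : Finset ι) n, ∏ c, z c ^ m c := by
  rw [sum_sum_fixedColourings, ← Finset.sum_fiberwise_of_maps_to (s := Finset.univ)
    (t := Finset.finsuppAntidiag (Finset.univ : Finset ι) n) (g := content), Finset.mul_sum]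
  · refine Finset.sum_congr rfl fun m hm => ?_
    rw [← sum_card_stab m (Finset.mem_finsuppAntidiag.1 hm).1, Nat.cast_sum, Finset.sum_mul]
    refine Finset.sum_congr rfl fun f hf => ?_
    rw [Finset.sum_const, nsmul_eq_mul]
    congr 1
    rw [← (Finset.mem_filter.1 hf).2, ← Finset.prod_fiberwise (s := Finset.univ) (g := f)]
    refine Finset.prod_congr rfl fun c _ => ?_
    rw [content_apply, ← Finset.prod_const]
    exact Finset.prod_congr rfl fun k hk => by rw [(Finset.mem_filter.1 hk).2]
  · intro f _
    rw [Finset.mem_finsuppAntidiag]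
    exact ⟨sum_content f, Finset.subset_univ _⟩

/-- The power sum product of the cycle type of `σ`, as a sum over fixed colourings. -/
def colourPoly (l : ℕ) (σ : Perm (Fin n)) : MvPolynomial (Fin l) ℂ :=
  ∑ f ∈ fixedColourings (Fin l) σ, ∏ k, X (f k)

/-- The coefficient of `x ^ ν` in the product of the alternant and a power sum product. -/
def frobCoeff {l : ℕ} (ν : Fin l →₀ ℕ) (σ : Perm (Fin n)) : ℂ :=
  coeff ν (alternant X * colourPoly l σ)

theorem coeff_coeff_map_C_mul_C {ι : Type*} (ν : ι →₀ ℕ) (p q : MvPolynomial ι ℂ) :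
    coeff ν (coeff ν (map C p * C q)) = coeff ν p * coeff ν q := by
  rw [mul_comm, coeff_C_mul, coeff_map, mul_comm, coeff_C_mul]

theorem prod_mul_C_pow {l : ℕ} (w : Perm (Fin l)) (m : Fin l →₀ ℕ) :
    (∏ i, ((X (w i) : MvPolynomial (Fin l) (MvPolynomial (Fin l) ℂ)) * C (X i)) ^ m i) =
      map C (monomial (m.mapDomain w) (1 : ℂ)) * C (monomial m 1) := by
  simp only [mul_pow, Finset.prod_mul_distrib]
  congr 1
  · rw [map_monomial, map_one, monomial_eq, map_one, one_mul,
      Finsupp.prod_mapDomain_index_inj w.injective, Finsupp.prod_fintype _ _ (by simp)]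
  · rw [monomial_eq, map_one, one_mul, Finsupp.prod_fintype _ _ (by simp), map_prod]
    simp

/-- The Frobenius coefficients of an exponent with distinct entries have norm `1`, by Cauchy's
determinant. -/
theorem sum_frobCoeff_mul_self {l : ℕ} (ν : Fin l →₀ ℕ) (hν : Function.Injective ν)
    (hs : ∑ i, ν i = n + ∑ i : Fin l, i.rev.1) :
    ∑ σ : Perm (Fin n), frobCoeff ν σ * frobCoeff ν σ = n.factorial := by
  -- two sets of variables, so that a product of coefficients is a single coefficient
  let x : Fin l → MvPolynomial (Fin l) (MvPolynomial (Fin l) ℂ) := X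
  let y : Fin l → MvPolynomial (Fin l) (MvPolynomial (Fin l) ℂ) := fun j => C (X j)
  have hy : Function.Injective y := fun i j e => X_injective (C_injective _ _ e)
  have h1 : ∀ σ : Perm (Fin n), map C (alternant X * colourPoly l σ) *
      C (alternant X * colourPoly l σ) = alternant x * alternant y *
        ∑ F ∈ fixedColourings (Fin l × Fin l) σ, ∏ k, (x (F k).1 * y (F k).2) := by
    intro σ
    rw [map_mul, map_mul, map_alternant, map_alternant,
      sum_fixedColourings_prod σ (fun c : Fin l × Fin l => x c.1 * y c.2), colourPoly,
      sum_fixedColourings_prod, map_multiset_prod, map_multiset_prod, Multiset.map_map,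
      Multiset.map_map]
    rw [mul_mul_mul_comm, ← Multiset.prod_map_mul]
    have h2 : (fun i => (map C : MvPolynomial (Fin l) ℂ →+* _) (X i)) = x := by
      ext1 i; simp [x]
    rw [h2]
    congr 3
    ext1 r
    simp [x, y, mul_pow, Fintype.sum_prod_type, Finset.sum_mul_sum]
  simp only [frobCoeff, ← coeff_coeff_map_C_mul_C, h1]
  rw [← coeff_sum, ← coeff_sum, ← Finset.mul_sum,
    sum_sum_fixedColourings_prod (fun c : Fin l × Fin l => x c.1 * y c.2), mul_left_comm,
    alternant_mul_alternant_mul_sum x y hy]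
  simp only [x, y, prod_mul_C_pow]
  have h3 : ((n.factorial : ℕ) : MvPolynomial (Fin l) (MvPolynomial (Fin l) ℂ)) =
      C (C (n.factorial : ℂ)) := by simp
  have h4 : ∀ z : ℤ, (z : MvPolynomial (Fin l) (MvPolynomial (Fin l) ℂ)) = C (C (z : ℂ)) := by
    simp
  simp only [h3, h4, coeff_C_mul, coeff_sum, coeff_coeff_map_C_mul_C, coeff_monomial]
  rw [Finset.sum_eq_single_of_mem 1 (Finset.mem_univ _), Finset.sum_eq_single_of_mem ν]
  · simp [Finsupp.mapDomain_id]
  · rw [Finset.mem_finsuppAntidiag]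
    exact ⟨hs, Finset.subset_univ _⟩
  · intro m _ hm
    rw [if_neg hm, mul_zero]
  · intro w _ hw
    refine mul_eq_zero_of_right _ (Finset.sum_eq_zero fun m _ => ?_)
    rw [ite_zero_mul_ite_zero, if_neg]
    rintro ⟨h5, rfl⟩
    refine hw (Equiv.ext fun i => ?_)
    rw [Perm.one_apply]
    apply hν
    conv_lhs => rw [← h5]
    rw [Finsupp.mapDomain_apply w.injective]

/-- The number of colourings of content `α` that are fixed by `σ`, the value at `σ` of a
permutation character. -/
def fixedCount {l : ℕ} (α : Fin l →₀ ℕ) (σ : Perm (Fin n)) : ℕ :=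
  ((fixedColourings (Fin l) σ).filter fun f => content f = α).card

theorem coeff_colourPoly {l : ℕ} (α : Fin l →₀ ℕ) (σ : Perm (Fin n)) :
    coeff α (colourPoly l σ) = fixedCount α σ := by
  rw [colourPoly, coeff_sum, fixedCount, Finset.card_filter, Nat.cast_sum]
  refine Finset.sum_congr rfl fun f _ => ?_
  have : ∏ k, (X (f k) : MvPolynomial (Fin l) ℂ) = monomial (content f) 1 := by
    rw [content, monomial_sum_one]
    rfl
  rw [this, coeff_monomial]
  simp

/-- The exponents of the term of the alternant that belongs to the permutation `w`. -/
def alternantExp {l : ℕ} (w : Perm (Fin l)) : Fin l →₀ ℕ :=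
  Finsupp.equivFunOnFinite.symm fun i => (w i).rev.1

theorem alternant_X_eq_sum (l : ℕ) :
    (alternant X : MvPolynomial (Fin l) ℂ) =
      ∑ w : Perm (Fin l), monomial (alternantExp w) (((Perm.sign w : ℤ)) : ℂ) := by
  rw [alternant, ← Matrix.det_transpose, Matrix.det_apply']
  refine Finset.sum_congr rfl fun w _ => ?_
  rw [monomial_eq, Finsupp.prod_fintype _ _ (by simp)]
  simp [Matrix.projVandermonde_apply, alternantExp]

theorem frobCoeff_eq_sum {l : ℕ} (ν : Fin l →₀ ℕ) (σ : Perm (Fin n)) :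
    frobCoeff ν σ = ∑ w : Perm (Fin l), if alternantExp w ≤ ν then
      ((Perm.sign w : ℤ) : ℂ) * fixedCount (ν - alternantExp w) σ else 0 := by
  rw [frobCoeff, alternant_X_eq_sum, Finset.sum_mul, coeff_sum]
  refine Finset.sum_congr rfl fun w _ => ?_
  rw [coeff_monomial_mul', coeff_colourPoly]

theorem conj_frobCoeff {l : ℕ} (ν : Fin l →₀ ℕ) (σ : Perm (Fin n)) :
    (starRingEnd ℂ) (frobCoeff ν σ) = frobCoeff ν σ := by
  rw [frobCoeff_eq_sum, map_sum]
  refine Finset.sum_congr rfl fun w _ => ?_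
  split_ifs <;> simp

end FrobeniusCoefficient

/-! ### The Frobenius character formula -/

section Frobenius

open MvPolynomial

/-- The parts of `p`, padded with zeros, as an exponent in `l` variables. -/
def rowExp (p : n.Partition) (l : ℕ) : Fin l →₀ ℕ :=
  Finsupp.equivFunOnFinite.symm fun i => (rows p).getD i.1 0

/-- The staircase exponent `(l - 1, …, 1, 0)`. -/
def staircase (l : ℕ) : Fin l →₀ ℕ := Finsupp.equivFunOnFinite.symm fun i => i.rev.1

theorem rowExp_apply (p : n.Partition) {l : ℕ} (i : Fin l) :
    rowExp p l i = (rows p).getD i.1 0 := rfl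

theorem staircase_apply {l : ℕ} (i : Fin l) : staircase l i = i.rev.1 := rfl

theorem rows_getD_anti (p : n.Partition) {i j : ℕ} (h : i ≤ j) :
    (rows p).getD j 0 ≤ (rows p).getD i 0 := by
  rcases lt_or_ge j (rows p).length with hj | hj
  · rw [List.getD_eq_getElem _ _ hj, List.getD_eq_getElem _ _ (h.trans_lt hj)]
    rcases h.eq_or_lt with rfl | h
    · exact le_rfl
    · exact List.pairwise_iff_getElem.1 (Multiset.pairwise_sort p.parts (· ≥ ·)) i j _ hj h
  · rw [List.getD_eq_default _ _ hj]
    exact Nat.zero_le _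

theorem mem_diagram {p : n.Partition} {i j : ℕ} :
    (i, j) ∈ (diagram p).cells ↔ j < (rows p).getD i 0 := by
  have h0 : (i, j) ∈ diagram p ↔ ∃ h : i < (rows p).length, j < (rows p)[i] :=
    YoungDiagram.mem_ofRowLens
  rw [YoungDiagram.mem_cells, h0]
  constructor
  · rintro ⟨h1, h2⟩
    rwa [List.getD_eq_getElem _ _ h1]
  · intro h
    have h1 : i < (rows p).length := by
      by_contra h1
      rw [List.getD_eq_default _ _ (not_lt.1 h1)] at h
      exact absurd h (Nat.not_lt_zero _)
    rw [List.getD_eq_getElem _ _ h1] at h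
    exact ⟨h1, h⟩

theorem rowIdx_lt_length {p : n.Partition} (T : Tableau p) (k : Fin n) :
    rowIdx T k < (rows p).length := by
  have h : (rowIdx T k, colIdx T k) ∈ (diagram p).cells := (T k).2
  by_contra h1
  rw [mem_diagram, List.getD_eq_default _ _ (not_lt.1 h1)] at h
  exact absurd h (Nat.not_lt_zero _)

/-- The colouring of the letters by their rows. -/
def rowColouring {p : n.Partition} (T : Tableau p) {l : ℕ} (hl : (rows p).length ≤ l)
    (k : Fin n) : Fin l := ⟨rowIdx T k, (rowIdx_lt_length T k).trans_le hl⟩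

theorem content_rowColouring {p : n.Partition} (T : Tableau p) {l : ℕ}
    (hl : (rows p).length ≤ l) : content (rowColouring T hl) = rowExp p l := by
  ext i
  rw [content_apply, rowExp_apply, ← Finset.card_range ((rows p).getD i.1 0)]
  refine Finset.card_bij (fun k _ => colIdx T k) ?_ ?_ ?_
  · intro k hk
    have h1 : rowIdx T k = i.1 := congrArg Fin.val (Finset.mem_filter.1 hk).2
    have h : (rowIdx T k, colIdx T k) ∈ (diagram p).cells := (T k).2
    rw [mem_diagram, h1] at h
    exact Finset.mem_range.2 h
  · intro k hk k' hk' e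
    have h1 : rowIdx T k = i.1 := congrArg Fin.val (Finset.mem_filter.1 hk).2
    have h2 : rowIdx T k' = i.1 := congrArg Fin.val (Finset.mem_filter.1 hk').2
    exact eq_of_rowIdx_eq_of_colIdx_eq T (h1.trans h2.symm) e
  · intro j hj
    have h : (i.1, j) ∈ (diagram p).cells := mem_diagram.2 (Finset.mem_range.1 hj)
    refine ⟨T.symm ⟨(i.1, j), h⟩, ?_, ?_⟩
    · simp [rowColouring, rowIdx, Fin.ext_iff]
    · simp [colIdx]

theorem card_val_lt_eq_sum_content {l : ℕ} (f : Fin n → Fin l) (i : ℕ) :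
    (Finset.univ.filter fun k => (f k).1 < i).card =
      ∑ j : Fin l with j.1 < i, content f j := by
  rw [Finset.card_eq_sum_card_fiberwise (f := f) (t := Finset.univ.filter fun j : Fin l => j.1 < i)]
  · refine Finset.sum_congr rfl fun j hj => ?_
    rw [content_apply, Finset.filter_filter]
    congr 1
    ext k
    simp only [Finset.mem_filter, Finset.mem_univ, true_and, and_iff_right_iff_imp]
    rintro rfl
    exact (Finset.mem_filter.1 hj).2
  · intro k hk
    simpa using hk

theorem stab_val_comp {l : ℕ} (f : Fin n → Fin l) : stab (fun k => (f k).1) = stab f := by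
  ext σ
  rw [mem_stab, mem_stab]
  exact (Fin.val_injective.comp_left).eq_iff (a := f ∘ σ) (b := f)

theorem card_stab_comp {ι : Type*} (f : Fin n → ι) (h : Perm (Fin n)) :
    (stab (f ∘ h)).card = (stab f).card := by
  refine Finset.card_equiv (MulAut.conj h).toEquiv fun τ => ?_
  simp only [MulEquiv.toEquiv_eq_coe, EquivLike.coe_coe, MulAut.conj_apply, mem_stab]
  have : f ∘ (h * τ * h⁻¹ : Perm (Fin n)) = ((f ∘ h) ∘ τ) ∘ (h⁻¹ : Perm (Fin n)) := rfl
  rw [this]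
  have h2 : f = (f ∘ h) ∘ (h⁻¹ : Perm (Fin n)) := by ext k; simp
  conv_rhs => rhs; rw [h2]
  exact (h⁻¹ : Perm (Fin n)).surjective.injective_comp_right.eq_iff.symm

theorem sum_fixedCount_mul {l : ℕ} (α : Fin l →₀ ℕ) (χ : Perm (Fin n) → ℂ) :
    ∑ σ, (fixedCount α σ : ℂ) * χ σ =
      ∑ f : Fin n → Fin l with content f = α, ∑ σ ∈ stab f, χ σ := by
  rw [Finset.sum_filter]
  have h : ∀ f : Fin n → Fin l, (if content f = α then ∑ σ ∈ stab f, χ σ else 0) =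
      ∑ σ ∈ stab f, if content f = α then χ σ else 0 := fun f => by
    split_ifs <;> simp
  simp only [h]
  rw [← sum_sum_fixedColourings fun σ f => if content f = α then χ σ else 0]
  refine Finset.sum_congr rfl fun σ _ => ?_
  rw [fixedCount, ← Finset.sum_filter, Finset.sum_const, nsmul_eq_mul]

theorem perm_eq_one_of_sum_le {l : ℕ} (w : Perm (Fin l))
    (h : ∀ i : ℕ, ∑ j : Fin l with j.1 < i, (w j).1 ≤ ∑ j : Fin l with j.1 < i, j.1) : w = 1 := by
  have key : ∀ i : ℕ, ∀ j : Fin l, j.1 = i → w j = j := by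
    intro i
    induction i using Nat.strong_induction_on with
    | _ i ih =>
      rintro j rfl
      have h1 : (Finset.univ.filter fun k : Fin l => k.1 < j.1 + 1) =
          insert j (Finset.univ.filter fun k : Fin l => k.1 < j.1) := by
        ext k
        simp only [Finset.mem_filter, Finset.mem_univ, true_and, Finset.mem_insert, Fin.ext_iff]
        omega
      have h2 := h (j.1 + 1)
      rw [h1, Finset.sum_insert (by simp), Finset.sum_insert (by simp)] at h2
      have h3 : ∑ k : Fin l with k.1 < j.1, (w k).1 = ∑ k : Fin l with k.1 < j.1, k.1 :=
        Finset.sum_congr rfl fun k hk => by rw [ih k.1 (Finset.mem_filter.1 hk).2 k rfl]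
      have h4 : (w j).1 ≤ j.1 := by omega
      rcases h4.eq_or_lt with h5 | h5
      · exact Fin.ext h5
      · exact w.injective (ih _ h5 (w j) rfl)
  exact Equiv.ext fun j => key j.1 j rfl

theorem sum_fixedCount_mul_character {p : n.Partition} (T : Tableau p) {l : ℕ}
    (hl : (rows p).length ≤ l) :
    ∑ σ, (fixedCount (rowExp p l) σ : ℂ) * (spechtRep T).character σ = n.factorial := by
  rw [sum_fixedCount_mul, ← content_rowColouring T hl, ← sum_card_stab (rowExp p l)
    (by rw [← content_rowColouring T hl, sum_content]), Nat.cast_sum, content_rowColouring]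
  refine Finset.sum_congr rfl fun f hf => ?_
  rw [← content_rowColouring T hl] at hf
  obtain ⟨h, rfl⟩ := exists_comp_eq_of_content_eq (Finset.mem_filter.1 hf).2.symm
  have h1 : stab (rowColouring T hl) = stab (rowIdx T) := (stab_val_comp _).symm
  have h2 : stab (rowColouring T hl ∘ h) = stab (rowIdx T ∘ h) := (stab_val_comp _).symm
  rw [card_stab_comp, h1, h2, sum_stab_character_rowIdx_comp]

/-- The permutation character of the content `λ + δ - w δ` is orthogonal to the irreducible
character for `w ≠ 1`, as this content is not dominated by `λ`. -/
theorem sum_fixedCount_mul_character_eq_zero {p : n.Partition} (T : Tableau p) {l : ℕ}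
    (hl : (rows p).length ≤ l) {w : Perm (Fin l)} (hw : w ≠ 1)
    (hle : alternantExp w ≤ rowExp p l + staircase l) :
    ∑ σ, (fixedCount (rowExp p l + staircase l - alternantExp w) σ : ℂ) *
      (spechtRep T).character σ = 0 := by
  rw [sum_fixedCount_mul]
  refine Finset.sum_eq_zero fun f hf => ?_
  have hf' := (Finset.mem_filter.1 hf).2
  have h1 : ∃ i : ℕ, ∑ j : Fin l with j.1 < i, j.1 < ∑ j : Fin l with j.1 < i, (w j).1 := by
    by_contra! h
    exact hw (perm_eq_one_of_sum_le w h)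
  obtain ⟨i, hi⟩ := h1
  rw [← stab_val_comp]
  refine sum_stab_character_eq_zero T _ (i := i) ?_
  have h2 := card_val_lt_eq_sum_content (rowColouring T hl) i
  rw [content_rowColouring] at h2
  refine lt_of_eq_of_lt h2 ?_
  rw [card_val_lt_eq_sum_content, hf']
  have h3 : ∀ j : Fin l, (rowExp p l + staircase l - alternantExp w) j + j.1 =
      rowExp p l j + (w j).1 := by
    intro j
    have h4 := hle j
    simp only [Finsupp.coe_tsub, Finsupp.coe_add, Pi.sub_apply, Pi.add_apply] at h4 ⊢
    have h5 : alternantExp w j = l - ((w j).1 + 1) := Fin.val_rev _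
    have h6 : staircase l j = l - (j.1 + 1) := Fin.val_rev _
    have h7 := (w j).2
    have h8 := j.2
    omega
  have h6 : ∑ j : Fin l with j.1 < i, ((rowExp p l + staircase l - alternantExp w) j + j.1) =
      ∑ j : Fin l with j.1 < i, (rowExp p l j + (w j).1) := Finset.sum_congr rfl fun j _ => h3 j
  rw [Finset.sum_add_distrib, Finset.sum_add_distrib] at h6
  omega

theorem sum_frobCoeff_mul_character {p : n.Partition} (T : Tableau p) {l : ℕ}
    (hl : (rows p).length ≤ l) :
    ∑ σ, frobCoeff (rowExp p l + staircase l) σ * (spechtRep T).character σ = n.factorial := by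
  simp only [frobCoeff_eq_sum, Finset.sum_mul]
  have h1 : alternantExp (1 : Perm (Fin l)) = staircase l := rfl
  rw [Finset.sum_comm, Finset.sum_eq_single_of_mem 1 (Finset.mem_univ _)]
  · rw [← sum_fixedCount_mul_character T hl]
    refine Finset.sum_congr rfl fun σ _ => ?_
    rw [h1, if_pos le_add_self, add_tsub_cancel_right]
    simp
  · intro w _ hw
    by_cases hle : alternantExp w ≤ rowExp p l + staircase l
    · simp only [if_pos hle, mul_assoc]
      rw [← Finset.mul_sum, sum_fixedCount_mul_character_eq_zero T hl hw hle, mul_zero]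
    · simp [if_neg hle]

theorem frobCoeff_eq_character {p : n.Partition} (T : Tableau p) {l : ℕ}
    (hl : (rows p).length ≤ l) (σ : Perm (Fin n)) :
    frobCoeff (rowExp p l + staircase l) σ = (spechtRep T).character σ := by
  set ν := rowExp p l + staircase l with hνdef
  have hν : Function.Injective ν := by
    refine StrictAnti.injective fun i j hij => ?_
    rw [hνdef, Finsupp.add_apply, Finsupp.add_apply, rowExp_apply, rowExp_apply, staircase_apply,
      staircase_apply]
    have h1 := rows_getD_anti p hij.le
    have h2 : j.rev.1 < i.rev.1 := Fin.rev_lt_rev.2 hij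
    exact add_lt_add_of_le_of_lt h1 h2
  have hs : ∑ i, ν i = n + ∑ i : Fin l, i.rev.1 := by
    simp only [hνdef, Finsupp.add_apply, Finset.sum_add_distrib]
    rw [← content_rowColouring T hl, sum_content]
    rfl
  have h1 := sum_frobCoeff_mul_self ν hν hs
  have h2 := sum_frobCoeff_mul_character T hl
  have h3 := sum_character_mul_self T
  rw [← hνdef] at h2
  -- the difference is a real function of norm `n! - 2 n! + n! = 0`
  set d : Perm (Fin n) → ℂ := fun σ => frobCoeff ν σ - (spechtRep T).character σ with hd
  have h4 : ∑ σ, d σ * d σ = 0 := by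
    have h5 : ∀ σ, d σ * d σ = frobCoeff ν σ * frobCoeff ν σ -
        2 * (frobCoeff ν σ * (spechtRep T).character σ) +
          (spechtRep T).character σ * (spechtRep T).character σ := fun σ => by
      simp only [hd]; ring
    simp only [h5, Finset.sum_add_distrib, Finset.sum_sub_distrib, ← Finset.mul_sum, h1, h2, h3]
    ring
  have h5 : ∀ σ, d σ = ((d σ).re : ℂ) := fun σ => by
    refine (Complex.conj_eq_iff_re.1 ?_).symm
    simp only [hd, map_sub, conj_frobCoeff, conj_character_spechtRep]
  have h6 : ∑ σ, (d σ).re * (d σ).re = 0 := by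
    have h7 : ∑ σ, d σ * d σ = ((∑ σ, (d σ).re * (d σ).re : ℝ) : ℂ) := by
      push_cast
      exact Finset.sum_congr rfl fun σ _ => by rw [← h5]
    rw [h7] at h4
    exact_mod_cast h4
  have h8 := (Finset.sum_eq_zero_iff_of_nonneg fun σ _ => mul_self_nonneg _).1 h6 σ
    (Finset.mem_univ _)
  have h9 : d σ = 0 := by rw [h5, mul_self_eq_zero.1 h8, Complex.ofReal_zero]
  exact sub_eq_zero.1 h9

theorem colourPoly_eq_psumPart {ρ : n.Partition} {σ : Perm (Fin n)}
    (h : σ.partition.parts = ρ.parts) (l : ℕ) : colourPoly l σ = psumPart (Fin l) ℂ ρ := by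
  rw [colourPoly, sum_fixedColourings_prod, h]
  rfl

/-- **Frobenius' character formula**: `χ^λ_ρ` is the coefficient of `x ^ (λ + δ)` in the product of
the alternant `a_δ` and the power sum product `p_ρ`. -/
theorem chi_eq_coeff (p ρ : n.Partition) {l : ℕ} (hl : (rows p).length ≤ l) :
    chi p ρ = coeff (rowExp p l + staircase l) (alternant X * psumPart (Fin l) ℂ ρ) := by
  obtain ⟨σ, hσ⟩ := exists_perm ρ
  rw [chi_eq p ρ σ hσ, ← frobCoeff_eq_character _ hl, frobCoeff, colourPoly_eq_psumPart hσ]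

end Frobenius

/-! ### Elementary symmetric polynomials in terms of power sums -/

section PowerSumExpansion

open MvPolynomial

/-- `z_s = ∏ i ^ mᵢ * mᵢ!` for a multiset `s` of positive integers. -/
def multisetZee (s : Multiset ℕ) : ℕ := ∏ i ∈ s.toFinset, i ^ s.count i * (s.count i).factorial

theorem multisetZee_eq_prod {s : Multiset ℕ} {t : Finset ℕ} (h : s.toFinset ⊆ t) :
    multisetZee s = ∏ i ∈ t, i ^ s.count i * (s.count i).factorial := by
  refine Finset.prod_subset h fun i _ hi => ?_
  rw [Multiset.count_eq_zero.2 fun e => hi (Multiset.mem_toFinset.2 e)]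
  simp

theorem multisetZee_cons (i : ℕ) (s : Multiset ℕ) :
    multisetZee (i ::ₘ s) = i * (i ::ₘ s).count i * multisetZee s := by
  have hi : i ∈ (i ::ₘ s).toFinset := by simp
  rw [multisetZee, multisetZee_eq_prod (s := s) (t := (i ::ₘ s).toFinset)
    (Multiset.toFinset_subset.2 (Multiset.subset_cons _ _)), ← Finset.mul_prod_erase _ _ hi,
    ← Finset.mul_prod_erase _ _ hi, ← mul_assoc, Multiset.count_cons_self, pow_succ,
    Nat.factorial_succ]
  congr 1
  · ring
  · refine Finset.prod_congr rfl fun j hj => ?_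
    rw [Multiset.count_cons_of_ne (Finset.ne_of_mem_erase hj)]

theorem multisetZee_ne_zero {s : Multiset ℕ} (hs : ∀ i ∈ s, 0 < i) : multisetZee s ≠ 0 :=
  Finset.prod_ne_zero_iff.2 fun i hi => mul_ne_zero
    (pow_ne_zero _ (hs i (Multiset.mem_toFinset.1 hi)).ne') (Nat.factorial_ne_zero _)

variable {ι : Type*} [Fintype ι]

/-- The term `(-1) ^ l(s) * p_s / z_s` of the power sum expansion of `(-1) ^ k * e_k`. -/
def psumTerm (ι : Type*) [Fintype ι] (s : Multiset ℕ) : MvPolynomial ι ℂ :=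
  C ((-1 : ℂ) ^ s.card / (multisetZee s : ℂ)) * (s.map (psum ι ℂ)).prod

theorem mul_psumTerm_cons {i : ℕ} {s : Multiset ℕ} (hi : 0 < i) (hs : ∀ j ∈ s, 0 < j) :
    ((i * (i ::ₘ s).count i : ℕ) : MvPolynomial ι ℂ) * psumTerm ι (i ::ₘ s) =
      -(psumTerm ι s * psum ι ℂ i) := by
  have h1 : (multisetZee s : ℂ) ≠ 0 := Nat.cast_ne_zero.2 (multisetZee_ne_zero hs)
  have h2 : ((i * (i ::ₘ s).count i : ℕ) : ℂ) ≠ 0 := by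
    rw [Multiset.count_cons_self]
    exact Nat.cast_ne_zero.2 (mul_ne_zero hi.ne' (Nat.succ_ne_zero _))
  have h3 : ((i * (i ::ₘ s).count i : ℕ) : ℂ) * ((-1 : ℂ) ^ (i ::ₘ s).card /
      (multisetZee (i ::ₘ s) : ℂ)) = -((-1 : ℂ) ^ s.card / (multisetZee s : ℂ)) := by
    rw [multisetZee_cons, Multiset.card_cons, Nat.cast_mul _ (multisetZee s), pow_succ]
    field_simp
  rw [psumTerm, psumTerm, ← mul_assoc, ← map_natCast (C : ℂ →+* MvPolynomial ι ℂ), ← map_mul, h3,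
    Multiset.map_cons, Multiset.prod_cons, map_neg]
  ring

/-- The partitions of `k`, as multisets of positive integers. -/
def partitionSet (k : ℕ) : Finset (Multiset ℕ) :=
  Finset.univ.image fun τ : k.Partition => τ.parts

theorem mem_partitionSet {k : ℕ} {s : Multiset ℕ} :
    s ∈ partitionSet k ↔ s.sum = k ∧ ∀ i ∈ s, 0 < i := by
  simp only [partitionSet, Finset.mem_image, Finset.mem_univ, true_and]
  constructor
  · rintro ⟨τ, rfl⟩
    exact ⟨τ.parts_sum, fun i hi => τ.parts_pos hi⟩
  · rintro ⟨h1, h2⟩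
    exact ⟨⟨s, fun {i} hi => h2 i hi, h1⟩, rfl⟩

theorem sum_partitionSet {A : Type*} [AddCommMonoid A] (k : ℕ) (F : Multiset ℕ → A) :
    ∑ s ∈ partitionSet k, F s = ∑ τ : k.Partition, F τ.parts :=
  Finset.sum_image fun _ _ _ _ h => Nat.Partition.ext h

/-- Removing a part: the pairs of a partition of `k` and one of its parts. -/
theorem sum_sum_toFinset_erase {A : Type*} [AddCommMonoid A] (k : ℕ) (F : ℕ → Multiset ℕ → A) :
    ∑ s ∈ partitionSet k, ∑ i ∈ s.toFinset, F i (s.erase i) =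
      ∑ a ∈ Finset.HasAntidiagonal.antidiagonal k with a.1 < k, ∑ s ∈ partitionSet a.1, F a.2 s := by
  rw [Finset.sum_sigma', Finset.sum_sigma']
  refine Finset.sum_bij' (fun x _ => ⟨(k - x.2, x.2), x.1.erase x.2⟩)
    (fun y _ => ⟨y.1.2 ::ₘ y.2, y.1.2⟩) ?_ ?_ ?_ ?_ ?_
  · rintro ⟨s, i⟩ h
    simp only [Finset.mem_sigma, mem_partitionSet, Multiset.mem_toFinset, Finset.mem_filter,
      Finset.HasAntidiagonal.mem_antidiagonal] at h ⊢
    obtain ⟨⟨h1, h2⟩, h3⟩ := h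
    have h4 := Multiset.sum_erase h3
    have h5 := h2 i h3
    exact ⟨⟨by omega, by omega⟩, by omega, fun j hj => h2 j (Multiset.mem_of_mem_erase hj)⟩
  · rintro ⟨⟨a, b⟩, s⟩ h
    simp only [Finset.mem_sigma, mem_partitionSet, Multiset.mem_toFinset, Finset.mem_filter,
      Finset.HasAntidiagonal.mem_antidiagonal, Multiset.sum_cons, Multiset.mem_cons] at h ⊢
    obtain ⟨⟨h1, h2⟩, h3, h4⟩ := h
    refine ⟨⟨by omega, ?_⟩, by simp⟩
    rintro j (rfl | hj)
    · omega
    · exact h4 j hj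
  · rintro ⟨s, i⟩ h
    simp only [Finset.mem_sigma, Multiset.mem_toFinset] at h
    simp [Multiset.cons_erase h.2]
  · rintro ⟨⟨a, b⟩, s⟩ h
    simp only [Finset.mem_sigma, mem_partitionSet, Finset.mem_filter,
      Finset.HasAntidiagonal.mem_antidiagonal] at h
    have : k - b = a := by omega
    simp [this]
  · rintro ⟨s, i⟩ h
    rfl

/-- `(-1) ^ k * e_k = ∑ (-1) ^ l(τ) * p_τ / z_τ`: both sides satisfy Newton's recursion. -/
theorem neg_one_pow_mul_esymm (k : ℕ) :
    (-1) ^ k * esymm ι ℂ k = ∑ s ∈ partitionSet k, psumTerm ι s := by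
  induction k using Nat.strong_induction_on with
  | _ k ih =>
    rcases Nat.eq_zero_or_pos k with rfl | hk
    · have : partitionSet 0 = {0} := by
        ext s
        rw [mem_partitionSet, Finset.mem_singleton]
        constructor
        · rintro ⟨h1, h2⟩
          refine Multiset.eq_zero_of_forall_notMem fun i hi => ?_
          have h3 := Multiset.le_sum_of_mem hi
          have h4 := h2 i hi
          omega
        · rintro rfl
          simp
      rw [this, Finset.sum_singleton, psumTerm]
      simp [multisetZee]
    · have h1 : (k : MvPolynomial ι ℂ) * ((-1) ^ k * esymm ι ℂ k) =
          -∑ a ∈ Finset.HasAntidiagonal.antidiagonal k with a.1 < k,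
            ∑ s ∈ partitionSet a.1, psumTerm ι s * psum ι ℂ a.2 := by
        rw [mul_left_comm, mul_esymm_eq_sum, ← mul_assoc, ← pow_add, ← add_assoc, pow_succ,
          Even.neg_one_pow ⟨k, rfl⟩, one_mul, neg_one_mul]
        refine congrArg Neg.neg (Finset.sum_congr rfl fun a ha => ?_)
        rw [ih a.1 (Finset.mem_filter.1 ha).2, Finset.sum_mul]
      have h2 : (k : MvPolynomial ι ℂ) * ∑ s ∈ partitionSet k, psumTerm ι s =
          ∑ s ∈ partitionSet k, ∑ i ∈ s.toFinset, -(psumTerm ι (s.erase i) * psum ι ℂ i) := by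
        rw [Finset.mul_sum]
        refine Finset.sum_congr rfl fun s hs => ?_
        obtain ⟨hs1, hs2⟩ := mem_partitionSet.1 hs
        have h3 : k = ∑ i ∈ s.toFinset, i * s.count i := by
          rw [← hs1, Finset.sum_multiset_count]
          exact Finset.sum_congr rfl fun i _ => by rw [smul_eq_mul, mul_comm]
        conv_lhs => rw [h3, Nat.cast_sum, Finset.sum_mul]
        refine Finset.sum_congr rfl fun i hi => ?_
        rw [Multiset.mem_toFinset] at hi
        have h4 := mul_psumTerm_cons (ι := ι) (i := i) (s := s.erase i) (hs2 i hi)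
          fun j hj => hs2 j (Multiset.mem_of_mem_erase hj)
        rwa [Multiset.cons_erase hi] at h4
      rw [sum_sum_toFinset_erase k fun i s => -(psumTerm ι s * psum ι ℂ i)] at h2
      refine mul_left_cancel₀ (Nat.cast_ne_zero.2 hk.ne' : (k : MvPolynomial ι ℂ) ≠ 0) ?_
      rw [h1, h2]
      simp only [Finset.sum_neg_distrib]

end PowerSumExpansion

/-! ### Separating the first variable -/

section FirstVariable

open MvPolynomial

theorem alternant_succ {R : Type*} [CommRing R] {l : ℕ} (x : Fin (l + 1) → R) :
    alternant x = (∏ i : Fin l, (x 0 - x i.succ)) * alternant fun i => x i.succ := by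
  simp [alternant, Matrix.det_projVandermonde, Fin.prod_univ_succ, Fin.prod_Ioi_succ]

theorem finSuccEquiv_alternant (l : ℕ) :
    finSuccEquiv ℂ l (alternant X) =
      (∏ i : Fin l, (Polynomial.X - Polynomial.C (X i))) * Polynomial.C (alternant X) := by
  simp only [map_alternant, alternant_succ fun i => finSuccEquiv ℂ l (X i), finSuccEquiv_X_zero,
    finSuccEquiv_X_succ]

theorem finSuccEquiv_psum (l r : ℕ) :
    finSuccEquiv ℂ l (psum (Fin (l + 1)) ℂ r) =
      Polynomial.X ^ r + Polynomial.C (psum (Fin l) ℂ r) := by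
  simp [psum, Fin.sum_univ_succ, finSuccEquiv_X_zero, finSuccEquiv_X_succ]

theorem map_get_rows {A : Type*} [CommMonoid A] (ρ : n.Partition) (F : ℕ → A) :
    (ρ.parts.map F).prod = ∏ i, F ((rows ρ).get i) := by
  have h2 : ((rows ρ : List ℕ) : Multiset ℕ) = ρ.parts := Multiset.sort_eq _ _
  conv_lhs => rw [← h2, ← List.ofFn_get (rows ρ), ← Fin.univ_val_map, Multiset.map_map]
  rfl

theorem finSuccEquiv_psumPart (l : ℕ) (ρ : n.Partition) :
    finSuccEquiv ℂ l (psumPart (Fin (l + 1)) ℂ ρ) =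
      ∑ S : Finset (Fin (rows ρ).length), Polynomial.X ^ subSize ρ S *
        Polynomial.C (((subParts ρ Sᶜ).map (psum (Fin l) ℂ)).prod) := by
  rw [psumPart, map_multiset_prod, Multiset.map_map, map_get_rows]
  simp only [Function.comp_apply, finSuccEquiv_psum]
  rw [Finset.prod_add, Finset.powerset_univ]
  refine Finset.sum_congr rfl fun S _ => ?_
  rw [Finset.prod_pow_eq_pow_sum, ← map_prod, subParts, Multiset.map_map, ← Finset.compl_eq_univ_sdiff]
  rfl

theorem coeff_prod_X_sub_C_mul_X_pow (l a d : ℕ) :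
    ((∏ i : Fin l, (Polynomial.X - Polynomial.C (X i : MvPolynomial (Fin l) ℂ))) *
      Polynomial.X ^ d).coeff (a + l) =
        if a ≤ d then (-1) ^ (d - a) * esymm (Fin l) ℂ (d - a) else 0 := by
  have h0 : (∏ i : Fin l, (Polynomial.X - Polynomial.C (X i : MvPolynomial (Fin l) ℂ))) =
      ((Finset.univ.val.map (X : Fin l → MvPolynomial (Fin l) ℂ)).map
        fun t => Polynomial.X - Polynomial.C t).prod := by
    rw [Multiset.map_map]; rfl
  have hcard : (Finset.univ.val.map (X : Fin l → MvPolynomial (Fin l) ℂ)).card = l := by simp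
  have hdeg : (∏ i : Fin l, (Polynomial.X -
      Polynomial.C (X i : MvPolynomial (Fin l) ℂ))).natDegree = l := by
    rw [h0, Polynomial.natDegree_multiset_prod_X_sub_C_eq_card, hcard]
  rw [Polynomial.coeff_mul_X_pow']
  split_ifs with h1 h2 h2
  · rw [h0, Multiset.prod_X_sub_C_coeff _ (by rw [hcard]; omega), hcard,
      esymm_eq_multiset_esymm]
    have : l - (a + l - d) = d - a := by omega
    rw [this]
  · exact Polynomial.coeff_eq_zero_of_natDegree_lt (by rw [hdeg]; omega)
  · have h3 : esymm (Fin l) ℂ (d - a) = 0 := by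
      rw [esymm, Finset.powersetCard_eq_empty.2 (by simp; omega), Finset.sum_empty]
    rw [h3, mul_zero]
  · omega

theorem rows_eq_cons (p : n.Partition) (h : p.parts ≠ 0) :
    rows p = firstPart p :: rows (removeFirst p) := by
  have h1 : p.parts = firstPart p ::ₘ (removeFirst p).parts :=
    (Multiset.cons_erase (firstPart_mem p h)).symm
  unfold rows
  conv_lhs => rw [h1]
  refine Multiset.sort_cons (r := (· ≥ ·)) _ _ fun b hb => ?_
  exact Multiset.le_sup (Multiset.mem_of_mem_erase hb)

theorem rows_removeFirst (p : n.Partition) : rows (removeFirst p) = (rows p).tail := by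
  by_cases h : p.parts = 0
  · simp [rows, removeFirst, h]
  · rw [rows_eq_cons p h, List.tail_cons]

theorem rows_getD_zero (p : n.Partition) : (rows p).getD 0 0 = firstPart p := by
  by_cases h : p.parts = 0
  · simp [rows, firstPart, h]
  · rw [rows_eq_cons p h, List.getD_cons_zero]

theorem rowExp_add_staircase_succ (p : n.Partition) (l : ℕ) :
    rowExp p (l + 1) + staircase (l + 1) =
      Finsupp.cons (firstPart p + l) (rowExp (removeFirst p) l + staircase l) := by
  ext i
  refine Fin.cases ?_ (fun j => ?_) i
  · rw [Finsupp.cons_zero, Finsupp.add_apply, rowExp_apply, staircase_apply, Fin.val_zero,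
      rows_getD_zero]
    simp
  · rw [Finsupp.cons_succ, Finsupp.add_apply, Finsupp.add_apply, rowExp_apply, rowExp_apply,
      staircase_apply, staircase_apply, rows_removeFirst, Fin.rev_succ]
    cases rows p <;> simp

end FirstVariable

end SymChar

end

theorem corollary3p10 {n : ℕ} (lam rho : n.Partition) :
    SymChar.chi lam rho =
      ∑ S : Finset (Fin (SymChar.rows rho).length),
        if h : SymChar.firstPart lam ≤ SymChar.subSize rho S then
          ∑ tau : (SymChar.subSize rho S - SymChar.firstPart lam).Partition,
            ((-1 : ℂ) ^ SymChar.len tau / (SymChar.zee tau : ℂ)) *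
              SymChar.chi (SymChar.removeFirst lam) (SymChar.replace rho S h tau)
        else 0 := by
  -- `l + 1` variables, so that there is a first variable even for the empty partition
  obtain ⟨l, hl⟩ : ∃ l, (SymChar.rows lam).length ≤ l := ⟨_, le_rfl⟩
  have hl' : (SymChar.rows (SymChar.removeFirst lam)).length ≤ l := by
    rw [SymChar.rows_removeFirst, List.length_tail]; omega
  rw [SymChar.chi_eq_coeff lam rho (hl.trans (Nat.le_succ l)), SymChar.rowExp_add_staircase_succ,
    ← MvPolynomial.finSuccEquiv_coeff_coeff, map_mul, SymChar.finSuccEquiv_alternant,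
    SymChar.finSuccEquiv_psumPart, Finset.mul_sum, Polynomial.finsetSum_coeff, MvPolynomial.coeff_sum]
  refine Finset.sum_congr rfl fun S _ => ?_
  rw [mul_mul_mul_comm, ← map_mul, Polynomial.coeff_mul_C, SymChar.coeff_prod_X_sub_C_mul_X_pow]
  split_ifs with h
  · rw [SymChar.neg_one_pow_mul_esymm, SymChar.sum_partitionSet, Finset.sum_mul,
      MvPolynomial.coeff_sum]
    refine Finset.sum_congr rfl fun tau _ => ?_
    rw [SymChar.chi_eq_coeff _ _ hl', MvPolynomial.psumPart, SymChar.replace, Multiset.map_add, Multiset.prod_add,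
      SymChar.psumTerm, mul_assoc, MvPolynomial.coeff_C_mul]
    refine congrArg (_ * MvPolynomial.coeff _ ·) ?_
    ring
  · simp
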